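/- Let $d\ge 1$, $T=[0,1]^d$, $\alpha>0$, $L>0$, $0<\beta_0\le 1$, $C_Z>0$ and $\sigma_0^2>0$. Write $\lfloor\alpha\rfloor=\max\{k\in\mathbb N_0 : k<\alpha\}$ and let $\mathcal H(\alpha,L)$ be the set of functions $\mu:T\to\mathbb R$ whose partial derivatives $\partial^{b}\mu$, $|b|\le\lfloor\alpha\rfloor$, exist on $T$ and satisfy $$\max_{|b|\le\lfloor\alpha\rfloor}\sup_{x\in T}|\partial^{b}\mu(x)|+\max_{|b|=\lfloor\alpha\rfloor}\ \sup_{x\ne y\in T}\frac{|\partial^{b}\mu(x)-\partial^{b}\mu(y)|}{\|x-y\|_\infty^{\alpha-\lfloor\alpha\rfloor}}\le L .$$ Let $\mathcal P_T(\beta_0,C_Z)$ be the class of centered, square integrable real random fields $Z$ on $T$ for which there are $\beta\in[\beta_0,1]$ and a random variable $M>0$ with $\mathbb E[M^2]+\mathbb E[Z(0)^2]\le C_Z$ such that almost surely $|Z(x)-Z(y)|\le M\|x-y\|_\infty^{\beta}$ for all $x,y\in T$. Let $f_1,\dots,f_d:[0,1]\to\mathbb R$ be Lipschitz continuous probability densities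 with $0<f_{k,\min}\le f_k\le f_{k,\max}<\infty$. For $p=(p_1,\dots,p_d)$ with positive integers $p_k$ let $x_{k,l}\in[0,1]$ be given by $$\int_0^{x_{k,l}}f_k(t)\,dt=\frac{l-0.5}{p_k},\qquad l=1,\dots,p_k,\quad k=1,\dots,d,$$ and put $x_j=(x_{1,j_1},\dots,x_{d,j_d})$ for $1\le j_k\le p_k$. One observes $$Y_{i,j}=\mu(x_j)+Z_i(x_j)+\varepsilon_{i,j},\qquad i=1,\dots,n,\quad 1\le j_k\le p_k\ (k=1,\dots,d),$$ where $Z_1,\dots,Z_n$ are independent copies of $Z$ and the $\varepsilon_{i,j}$ are i.i.d. $\mathcal N(0,\sigma_0^2)$, independent of $Z_1,\dots,Z_n$. With $p_{\min}=\min_k p_k$ and $p^{1}=\prod_{k=1}^d p_k$ set $$a_{n,p}=\max\Big\{p_{\min}^{-\alpha},\ \Big(\frac{\log(n\,p^{1})}{n\,p^{1}}\Big)^{\frac{\alpha}{2\alpha+d}},\ n^{-1/2}\Big\}.$$ Then there is a constant $c>0$ such that $$\liminf_{n\to\infty,\ p_{\min}\to\infty}\ \inf_{\hat\mu}\ \sup_{\mu\in\mathcal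 H(\alpha,L),\ Z\in\mathcal P_T(\beta_0,C_Z)}\ \mathbb E_{\mu,Z}\Big[a_{n,p}^{-1}\,\sup_{x\in T}|\hat\mu(x)-\mu(x)|\Big]\ \ge\ c ,$$ where the infimum is over all estimators $\hat\mu$, i.e. all real functions on $T$ each of whose values is a measurable function of the observations $(Y_{i,j})$. -/

import Mathlib

open MeasureTheory ProbabilityTheory Filter
open scoped ENNReal NNReal

noncomputable section

namespace FDAMean

/-- The hypercube `T = [0,1]^d`. Functions on `T` are represented by total functions on
`Fin d → ℝ`; no definition below looks at their values outside `T`. The norm of `Fin d → ℝ` is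
the maximum norm. -/
abbrev cube (d : ℕ) : Set (Fin d → ℝ) := Set.Icc 0 1

/-! ### Hölder classes -/

/-- The largest natural number that is strictly smaller than `α` (for `α > 0`). -/
def strictFloor (α : ℝ) : ℕ := ⌈α⌉₊ - 1

theorem strictFloor_isGreatest {α : ℝ} (hα : 0 < α) :
    IsGreatest {k : ℕ | (k : ℝ) < α} (strictFloor α) := by
  have h1 : 0 < ⌈α⌉₊ := Nat.ceil_pos.mpr hα
  refine ⟨?_, fun k hk => ?_⟩
  · have h2 : strictFloor α < ⌈α⌉₊ := by
      unfold strictFloor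
      omega
    exact Nat.lt_ceil.mp h2
  · have : k < ⌈α⌉₊ := Nat.lt_ceil.mpr hk
    unfold strictFloor
    omega

/-- The partial derivative in direction `k` of a function on the cube (one-sided on the faces). -/
def partialDeriv {d : ℕ} (k : Fin d) (f : (Fin d → ℝ) → ℝ) : (Fin d → ℝ) → ℝ :=
  fun x => derivWithin (fun t : ℝ => f (Function.update x k t)) (Set.Icc 0 1) (x k)

/-- The partial derivative in direction `k` exists at every point of the cube. -/
def HasPartialDeriv {d : ℕ} (k : Fin d) (f : (Fin d → ℝ) → ℝ) : Prop :=
  ∀ x ∈ cube d, DifferentiableWithinAt ℝ (fun t : ℝ => f (Function.update x k t))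
    (Set.Icc 0 1) (x k)

/-- `∂^b f = ∂₁^{b₁} ⋯ ∂_d^{b_d} f`. -/
def multiDeriv {d : ℕ} (b : Fin d → ℕ) (f : (Fin d → ℝ) → ℝ) : (Fin d → ℝ) → ℝ :=
  (List.finRange d).foldr (fun k g => (partialDeriv k)^[b k] g) f

/-- All partial derivatives of `f` on the cube up to order `m` exist. -/
def HasDerivsUpTo {d : ℕ} (m : ℕ) (f : (Fin d → ℝ) → ℝ) : Prop :=
  ∀ b : Fin d → ℕ, ∑ k, b k < m → ∀ k, HasPartialDeriv k (multiDeriv b f)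

/-- The Hölder norm of index `α` on the cube, with value `∞` allowed. -/
def holderNorm {d : ℕ} (α : ℝ) (f : (Fin d → ℝ) → ℝ) : ℝ≥0∞ :=
  (⨆ (b : Fin d → ℕ) (_ : ∑ k, b k ≤ strictFloor α) (x ∈ cube d), ‖multiDeriv b f x‖ₑ) +
  ⨆ (b : Fin d → ℕ) (_ : ∑ k, b k = strictFloor α) (x ∈ cube d) (y ∈ cube d) (_ : x ≠ y),
    ‖multiDeriv b f x - multiDeriv b f y‖ₑ / ENNReal.ofReal (‖x - y‖ ^ (α - strictFloor α))

/-- The Hölder class `H_T(α, L)`. -/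
def holderClass (d : ℕ) (α L : ℝ) : Set ((Fin d → ℝ) → ℝ) :=
  {f | HasDerivsUpTo (strictFloor α) f ∧ holderNorm α f ≤ ENNReal.ofReal L}

/-! ### The random fields -/

/-- A real random field on the cube. -/
structure RandomField (d : ℕ) where
  Ω : Type
  [mΩ : MeasurableSpace Ω]
  P : Measure Ω
  [isProb : IsProbabilityMeasure P]
  Z : (Fin d → ℝ) → Ω → ℝ
  meas : ∀ x ∈ cube d, Measurable (Z x)

attribute [instance] RandomField.mΩ RandomField.isProb

/-- The class `P_T(β₀, C_Z)` of centered, square integrable random fields with Hölder continuous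
paths. -/
def processClass (d : ℕ) (β₀ C_Z : ℝ) : Set (RandomField d) :=
  {Z | (∀ x ∈ cube d, MemLp (Z.Z x) 2 Z.P ∧ ∫ ω, Z.Z x ω ∂Z.P = 0) ∧
    ∃ β ∈ Set.Icc β₀ 1, ∃ M : Z.Ω → ℝ,
      Measurable M ∧ (∀ ω, 0 < M ω) ∧ MemLp M 2 Z.P ∧
      ∫ ω, M ω ^ 2 ∂Z.P + ∫ ω, Z.Z 0 ω ^ 2 ∂Z.P ≤ C_Z ∧
      ∀ᵐ ω ∂Z.P, ∀ x ∈ cube d, ∀ y ∈ cube d,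
        |Z.Z x ω - Z.Z y ω| ≤ M ω * ‖x - y‖ ^ β}

/-! ### The design -/

/-- `f` is a Lipschitz continuous probability density on `[0,1]` bounded away from `0` and `∞`. -/
structure IsDesignDensity (f : ℝ → ℝ) : Prop where
  lipschitz : ∃ K : ℝ≥0, LipschitzOnWith K f (Set.Icc 0 1)
  bounds : ∃ fmin fmax : ℝ, 0 < fmin ∧ ∀ t ∈ Set.Icc (0 : ℝ) 1, fmin ≤ f t ∧ f t ≤ fmax
  integral_eq_one : ∫ t in (0 : ℝ)..1, f t = 1

/-- The multi-indices `1 ≤ j ≤ p`, counted from `0` in each coordinate. -/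
abbrev GridIndex {d : ℕ} (p : Fin d → ℕ) : Type := ∀ k, Fin (p k)

/-- The coordinates `x k l` of a design with `p k` points in direction `k` are the
`(l - 0.5) / p k` quantiles of the density `f k`, `l = 1, …, p k` (here `l` counts from `0`). -/
def IsDesign {d : ℕ} (f : Fin d → ℝ → ℝ) (p : Fin d → ℕ) (x : ∀ k, Fin (p k) → ℝ) : Prop :=
  ∀ (k : Fin d) (l : Fin (p k)), x k l ∈ Set.Icc (0 : ℝ) 1 ∧
    ∫ t in (0 : ℝ)..(x k l), f k t = (((l : ℕ) : ℝ) + 1 - 0.5) / (p k : ℝ)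

/-- The point `x_j` of the Cartesian product design. -/
def gridPoint {d : ℕ} {p : Fin d → ℕ} (x : ∀ k, Fin (p k) → ℝ) (j : GridIndex p) : Fin d → ℝ :=
  fun k => x k (j k)

/-! ### Model, estimators and risk -/

/-- The observations `(Y_{i,j})`. -/
abbrev Obs (n : ℕ) {d : ℕ} (p : Fin d → ℕ) : Type := Fin n → GridIndex p → ℝ

/-- The law of `Y_{i,j} = μ(x_j) + Z_i(x_j) + ε_{i,j}` with `Z_1, …, Z_n` independent copies of `Z`
and, independently of these, `ε_{i,j}` i.i.d. `N(0, v)`. -/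
def obsLaw {d : ℕ} (n : ℕ) {p : Fin d → ℕ} (x : ∀ k, Fin (p k) → ℝ) (v : ℝ≥0)
    (μ : (Fin d → ℝ) → ℝ) (Z : RandomField d) : Measure (Obs n p) :=
  ((Measure.pi fun _ : Fin n => Z.P).prod
      (Measure.pi fun _ : Fin n => Measure.pi fun _ : GridIndex p => gaussianReal 0 v)).map
    fun q i j => μ (gridPoint x j) + Z.Z (gridPoint x j) (q.1 i) + q.2 i j

/-- Estimators of a function on the cube: every value is a measurable function of the data. -/
def estimators (n : ℕ) {d : ℕ} (p : Fin d → ℕ) : Set (Obs n p → (Fin d → ℝ) → ℝ) :=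
  {m | ∀ x ∈ cube d, Measurable fun y => m y x}

/-- The supremum distance `‖f - g‖_∞` on the cube, with value `∞` allowed. -/
def supDist {d : ℕ} (f g : (Fin d → ℝ) → ℝ) : ℝ≥0∞ := ⨆ x ∈ cube d, ‖f x - g x‖ₑ

/-- The rate `a_{n,p}`. -/
def rate {d : ℕ} (α : ℝ) (n : ℕ) (p : Fin d → ℕ) : ℝ :=
  max (((⨅ k, p k : ℕ) : ℝ) ^ (-α))
    (max ((Real.log (n * ∏ k, (p k : ℝ)) / (n * ∏ k, (p k : ℝ))) ^ (α / (2 * α + d)))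
      ((n : ℝ) ^ (-(1 / 2) : ℝ)))

/-- The minimax risk for the supremum norm, normalised by the rate. -/
def minimaxRisk {d : ℕ} (α L β₀ C_Z : ℝ) (v : ℝ≥0) (n : ℕ) (p : Fin d → ℕ)
    (x : ∀ k, Fin (p k) → ℝ) : ℝ≥0∞ :=
  ⨅ m ∈ estimators n p, ⨆ μ ∈ holderClass d α L, ⨆ Z ∈ processClass d β₀ C_Z,
    ∫⁻ y, (ENNReal.ofReal (rate α n p))⁻¹ * supDist (m y) μ ∂(obsLaw n x v μ Z)

end FDAMean

end

noncomputable section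

namespace FDAMean

/-! ### Product measures and Gaussian shifts -/

/-! The rate is a maximum of three terms, so it suffices to bound the maximal risk of an arbitrary
estimator below by a constant multiple of each. Every bound compares the zero function, observed
with the zero field, against alternatives that the data can hardly distinguish from it. The
estimator is evaluated only at finitely many points, because the supremum distance need not be
measurable in the data.

Discretisation (`exists_le_maxRisk_discretisation`): a bump of width of order `1 / p_min`, and hence
of height of order `p_min ^ (-α)`, fits between a face of the cube and the first layer of design
points. It leaves the law of the data unchanged.

Parametric (`exists_le_maxRisk_parametric`): a constant shift `δ` of order `n ^ (-1/2)` is cancelled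
by a centered two-point field that equals `-δ` except with probability `1 / (2 n)`. With probability
at least `1 / 2` no curve shows the exceptional value, and the data are then pure noise. The common
part of the two laws therefore has mass at least `1 / 2`, and `le_of_common_part` applies.

Stochastic (`exists_le_maxRisk_stochastic`): with `N = n * ∏ p_k` and `h = (log N / N) ^ (1 / (2α +
d))`, about `1 / h` disjoint bumps of height of order `h ^ α` are placed in the cube. Their
likelihood ratios have cross moments `1` and second moments at most the number of bumps, since `N *
h ^ (2α + d) = log N`. Hence their uniform mixture is not separated from pure noise
(`half_le_lintegral_min_average`, `le_of_mixture`). Counting design points under a bump needs `h *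
p_k ≥ 1` for all `k`; when this fails, `h ^ α` is smaller than `p_min ^ (-α)` and the discretisation
bound takes over. -/

theorem lintegral_pi_prod {ι : Type*} [Fintype ι] {E : ι → Type*} [∀ i, MeasurableSpace (E i)]
    (μ : ∀ i, Measure (E i)) [∀ i, IsProbabilityMeasure (μ i)] {g : ∀ i, E i → ℝ≥0∞}
    (hg : ∀ i, Measurable (g i)) :
    ∫⁻ y, ∏ i, g i (y i) ∂Measure.pi μ = ∏ i, ∫⁻ t, g i t ∂μ i := by
  have hind : iIndepFun (fun i (y : ∀ i, E i) => g i (y i)) (Measure.pi μ) :=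
    iIndepFun_pi (X := g) fun i => (hg i).aemeasurable
  have h := lintegral_prod_eq_prod_lintegral_of_indepFun Finset.univ _ hind
    fun i => (hg i).comp (measurable_pi_apply i)
  rw [h]
  refine Finset.prod_congr rfl fun i _ => ?_
  exact (measurePreserving_eval μ i).lintegral_comp (hg i)

theorem pi_withDensity {ι : Type*} [Fintype ι] {E : ι → Type*} [∀ i, MeasurableSpace (E i)]
    (μ : ∀ i, Measure (E i)) [∀ i, IsProbabilityMeasure (μ i)] {g : ∀ i, E i → ℝ≥0∞}
    (hg : ∀ i, Measurable (g i)) [∀ i, SigmaFinite ((μ i).withDensity (g i))] :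
    Measure.pi (fun i => (μ i).withDensity (g i)) =
      (Measure.pi μ).withDensity fun y => ∏ i, g i (y i) := by
  refine Measure.pi_eq fun s hs => ?_
  rw [withDensity_apply _ (MeasurableSet.univ_pi hs),
    ← lintegral_indicator (MeasurableSet.univ_pi hs)]
  have : ∀ y : ∀ i, E i, (Set.univ.pi s).indicator (fun y => ∏ i, g i (y i)) y =
      ∏ i, (s i).indicator (g i) (y i) := by
    intro y
    by_cases hy : y ∈ Set.univ.pi s
    · rw [Set.indicator_of_mem hy]
      exact Finset.prod_congr rfl fun i _ => (Set.indicator_of_mem (hy i trivial) _).symm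
    · rw [Set.indicator_of_notMem hy]
      simp only [Set.mem_pi, Set.mem_univ, true_implies, not_forall] at hy
      obtain ⟨i, hi⟩ := hy
      exact (Finset.prod_eq_zero (Finset.mem_univ i) (Set.indicator_of_notMem hi _)).symm
  simp_rw [this]
  rw [lintegral_pi_prod μ fun i => (hg i).indicator (hs i)]
  refine Finset.prod_congr rfl fun i _ => ?_
  rw [lintegral_indicator (hs i), withDensity_apply _ (hs i)]

/-- The density of `N(a, v)` with respect to `N(0, v)`. -/
def gaussianRatio (v : ℝ≥0) (a y : ℝ) : ℝ≥0∞ :=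
  ENNReal.ofReal (Real.exp ((a * y - a ^ 2 / 2) / v))

theorem measurable_gaussianRatio (v : ℝ≥0) (a : ℝ) : Measurable (gaussianRatio v a) := by
  unfold gaussianRatio
  fun_prop

theorem gaussianReal_withDensity_gaussianRatio {v : ℝ≥0} (hv : v ≠ 0) (a : ℝ) :
    (gaussianReal 0 v).withDensity (gaussianRatio v a) = gaussianReal a v := by
  rw [gaussianReal_of_var_ne_zero _ hv, gaussianReal_of_var_ne_zero _ hv,
    ← withDensity_mul _ (measurable_gaussianPDF _ _) (measurable_gaussianRatio _ _)]
  congr 1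
  ext y
  have hv' : (v : ℝ) ≠ 0 := by exact_mod_cast hv
  rw [Pi.mul_apply, gaussianPDF, gaussianPDF, gaussianRatio,
    ← ENNReal.ofReal_mul (gaussianPDFReal_nonneg _ _ _), gaussianPDFReal, gaussianPDFReal, mul_assoc,
    ← Real.exp_add]
  congr 3
  field_simp
  ring

/-- The integrand is a constant times the exponential of a linear function, so the Gaussian moment
generating function at `(a + b) / v` evaluates it; the squares cancel and only the cross term
survives. -/
theorem lintegral_gaussianRatio_mul {v : ℝ≥0} (hv : v ≠ 0) (a b : ℝ) :
    ∫⁻ y, gaussianRatio v a y * gaussianRatio v b y ∂gaussianReal 0 v =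
      ENNReal.ofReal (Real.exp (a * b / v)) := by
  have hv' : (v : ℝ) ≠ 0 := by exact_mod_cast hv
  have h1 : ∀ y, gaussianRatio v a y * gaussianRatio v b y =
      ENNReal.ofReal (Real.exp (-(a ^ 2 + b ^ 2) / (2 * v))) *
        ENNReal.ofReal (Real.exp ((a + b) / v * y)) := by
    intro y
    rw [gaussianRatio, gaussianRatio, ← ENNReal.ofReal_mul (Real.exp_nonneg _),
      ← ENNReal.ofReal_mul (Real.exp_nonneg _), ← Real.exp_add, ← Real.exp_add]
    congr 2
    field_simp
    ring
  simp_rw [h1]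
  rw [lintegral_const_mul _ (by fun_prop),
    ← ofReal_integral_eq_lintegral_ofReal (integrable_exp_mul_gaussianReal _)
      (ae_of_all _ fun _ => Real.exp_nonneg _)]
  have h2 := congrFun (mgf_id_gaussianReal (μ := 0) (v := v)) ((a + b) / v)
  simp only [mgf, id] at h2
  rw [h2, ← ENNReal.ofReal_mul (Real.exp_nonneg _), ← Real.exp_add]
  congr 2
  field_simp
  ring

/-- The law of `n × J` independent `N(0, v)` variables. -/
def noiseLaw (n : ℕ) (J : Type*) [Fintype J] (v : ℝ≥0) : Measure (Fin n → J → ℝ) :=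
  Measure.pi fun _ => Measure.pi fun _ => gaussianReal 0 v

instance (n : ℕ) (J : Type*) [Fintype J] (v : ℝ≥0) : IsProbabilityMeasure (noiseLaw n J v) := by
  unfold noiseLaw
  infer_instance

/-- The density of the Gaussian noise shifted by `θ` in every row. -/
def shiftRatio {n : ℕ} {J : Type*} [Fintype J] (v : ℝ≥0) (θ : J → ℝ) (y : Fin n → J → ℝ) : ℝ≥0∞ :=
  ∏ i, ∏ j, gaussianRatio v (θ j) (y i j)

theorem measurable_shiftRatio {n : ℕ} {J : Type*} [Fintype J] (v : ℝ≥0) (θ : J → ℝ) :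
    Measurable (shiftRatio (n := n) v θ) := by
  unfold shiftRatio
  refine Finset.measurable_prod _ fun i _ => Finset.measurable_prod _ fun j _ => ?_
  exact (measurable_gaussianRatio v (θ j)).comp (by fun_prop)

theorem noiseLaw_map_shift {n : ℕ} {J : Type*} [Fintype J] {v : ℝ≥0} (hv : v ≠ 0) (θ : J → ℝ) :
    (noiseLaw n J v).map (fun y i j => θ j + y i j) =
      (noiseLaw n J v).withDensity (shiftRatio v θ) := by
  have hrow : (Measure.pi fun _ : J => gaussianReal 0 v).map (fun y j => θ j + y j) =
      (Measure.pi fun _ : J => gaussianReal 0 v).withDensity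
        fun y => ∏ j, gaussianRatio v (θ j) (y j) := by
    rw [Measure.pi_map_pi (f := fun j t => θ j + t) fun j => by fun_prop]
    have : ∀ j, SigmaFinite ((gaussianReal 0 v).withDensity (gaussianRatio v (θ j))) := fun j => by
      rw [gaussianReal_withDensity_gaussianRatio hv]
      infer_instance
    rw [← pi_withDensity _ fun j => measurable_gaussianRatio v (θ j)]
    congr 1
    ext1 j
    rw [gaussianReal_withDensity_gaussianRatio hv, gaussianReal_map_const_add, zero_add]
  have hmap : Measurable fun (y : J → ℝ) j => θ j + y j := by fun_prop
  have hprob : IsProbabilityMeasure ((Measure.pi fun _ : J => gaussianReal 0 v).map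
      (fun y j => θ j + y j)) := Measure.isProbabilityMeasure_map hmap.aemeasurable
  unfold noiseLaw
  rw [Measure.pi_map_pi (f := fun (_ : Fin n) (y : J → ℝ) j => θ j + y j)
    fun i => hmap.aemeasurable]
  simp_rw [hrow] at hprob ⊢
  exact pi_withDensity (fun _ : Fin n => Measure.pi fun _ : J => gaussianReal 0 v) fun _ =>
    Finset.measurable_prod _ fun j _ => (measurable_gaussianRatio v (θ j)).comp (by fun_prop)

/-- Independence multiplies the one-dimensional moments. Shifts with disjoint supports thus have
cross moment exactly `1`, while the diagonal moment measures how detectable a single shift is. -/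
theorem lintegral_shiftRatio_mul {n : ℕ} {J : Type*} [Fintype J] {v : ℝ≥0} (hv : v ≠ 0)
    (θ η : J → ℝ) :
    ∫⁻ y, shiftRatio v θ y * shiftRatio v η y ∂noiseLaw n J v =
      ENNReal.ofReal (Real.exp (n * (∑ j, θ j * η j) / v)) := by
  have hm : ∀ j, Measurable fun t => gaussianRatio v (θ j) t * gaussianRatio v (η j) t :=
    fun j => (measurable_gaussianRatio v _).mul (measurable_gaussianRatio v _)
  simp_rw [shiftRatio, ← Finset.prod_mul_distrib]
  rw [noiseLaw, lintegral_pi_prod (fun _ : Fin n => Measure.pi fun _ : J => gaussianReal 0 v)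
    (g := fun _ y => ∏ j, (gaussianRatio v (θ j) (y j) * gaussianRatio v (η j) (y j)))
    fun _ => Finset.measurable_prod _ fun j _ => (hm j).comp (by fun_prop)]
  simp_rw [lintegral_pi_prod (fun _ : J => gaussianReal 0 v) hm, lintegral_gaussianRatio_mul hv]
  rw [Finset.prod_const, Finset.card_univ, Fintype.card_fin,
    ← ENNReal.ofReal_prod_of_nonneg fun _ _ => Real.exp_nonneg _, ← Real.exp_sum,
    ← ENNReal.ofReal_pow (Real.exp_nonneg _), ← Real.exp_nat_mul, ← Finset.sum_div, mul_div_assoc]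

/-! ### Lower bounds for the maximum of two or more risks -/

/-- This is `(l - 2) ^ 2 ≥ 0` when `l ≥ 1`. It turns a second moment bound into a lower bound for
the truncated mean: mean `1` and second moment `2` leave `1 - 2 / 4`. -/
theorem le_min_one_add_sq_div_four (l : ℝ≥0∞) : l ≤ min 1 l + l * l / 4 := by
  rcases eq_or_ne l ∞ with rfl | hl
  · simp [ENNReal.top_div]
  lift l to ℝ≥0 using hl
  rcases le_total l 1 with h | h
  · have : (l : ℝ≥0∞) ≤ 1 := by exact_mod_cast h
    rw [min_eq_right this]
    exact le_self_add
  · have : (1 : ℝ≥0∞) ≤ l := by exact_mod_cast h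
    rw [min_eq_left this]
    have h4 : (4 : ℝ≥0∞) = ((4 : ℝ≥0) : ℝ≥0∞) := by norm_num
    rw [h4, ← ENNReal.coe_mul, ← ENNReal.coe_div (by norm_num), ← ENNReal.coe_one,
      ← ENNReal.coe_add, ENNReal.coe_le_coe, ← NNReal.coe_le_coe]
    push_cast
    nlinarith [sq_nonneg ((l : ℝ) - 2)]

/-- The average of nearly orthogonal likelihood ratios stays comparable to `1`. -/
theorem half_le_lintegral_min_average {Y : Type*} [MeasurableSpace Y] (P : Measure Y)
    {ι : Type*} [Fintype ι] [Nonempty ι] {ℓ : ι → Y → ℝ≥0∞}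
    (hm : ∀ k, Measurable (ℓ k)) (h1 : ∀ k, ∫⁻ y, ℓ k y ∂P = 1)
    (hoff : ∀ k l, k ≠ l → ∫⁻ y, ℓ k y * ℓ l y ∂P ≤ 1)
    (hdiag : ∀ k, ∫⁻ y, ℓ k y * ℓ k y ∂P ≤ Fintype.card ι) :
    2⁻¹ ≤ ∫⁻ y, min 1 ((Fintype.card ι : ℝ≥0∞)⁻¹ * ∑ k, ℓ k y) ∂P := by
  classical
  set N : ℝ≥0∞ := (Fintype.card ι : ℝ≥0∞) with hN
  have hN0 : N ≠ 0 := by simp [hN]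
  have hNt : N ≠ ∞ := by simp [hN]
  have hs : Measurable fun y => ∑ k, ℓ k y := Finset.measurable_sum _ fun k _ => hm k
  have hmul : ∀ k l, Measurable fun y => ℓ k y * ℓ l y := fun k l => (hm k).mul (hm l)
  have hrowm : ∀ k, Measurable fun y => ∑ l, ℓ k y * ℓ l y := fun k =>
    Finset.measurable_sum _ fun l _ => hmul k l
  have hmean : ∫⁻ y, N⁻¹ * ∑ k, ℓ k y ∂P = 1 := by
    rw [lintegral_const_mul _ hs, lintegral_finsetSum _ fun k _ => hm k]
    simp [h1, ← hN, ENNReal.inv_mul_cancel hN0 hNt]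
  -- Each row of the matrix of mixed moments sums to at most `2 * N`: one diagonal entry up to `N`,
  -- the others up to `1`. There are `N` rows and a factor `N⁻¹ * N⁻¹`.
  have hsq : ∫⁻ y, (N⁻¹ * ∑ k, ℓ k y) * (N⁻¹ * ∑ k, ℓ k y) ∂P ≤ 2 := by
    have : ∀ y, (N⁻¹ * ∑ k, ℓ k y) * (N⁻¹ * ∑ k, ℓ k y) =
        (N⁻¹ * N⁻¹) * ∑ k, ∑ l, ℓ k y * ℓ l y := fun y => by
      rw [← Finset.sum_mul_sum]; ring
    simp_rw [this]
    rw [lintegral_const_mul _ (Finset.measurable_sum _ fun k _ => hrowm k),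
      lintegral_finsetSum _ fun k _ => hrowm k]
    have hrow : ∀ k, ∫⁻ y, ∑ l, ℓ k y * ℓ l y ∂P ≤ 2 * N := by
      intro k
      rw [lintegral_finsetSum _ fun l _ => hmul k l]
      calc ∑ l, ∫⁻ y, ℓ k y * ℓ l y ∂P ≤ ∑ l, ((if l = k then N else 0) + 1) := by
            refine Finset.sum_le_sum fun l _ => ?_
            by_cases h : l = k
            · subst h
              simpa using (hdiag l).trans le_self_add
            · simpa [h] using hoff k l (Ne.symm h)
        _ = 2 * N := by
            rw [Finset.sum_add_distrib]
            simp [hN, two_mul]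
    calc N⁻¹ * N⁻¹ * ∑ k, ∫⁻ y, ∑ l, ℓ k y * ℓ l y ∂P
        ≤ N⁻¹ * N⁻¹ * ∑ _k : ι, 2 * N := by gcongr with k; exact hrow k
      _ = 2 * (N⁻¹ * N) * (N⁻¹ * N) := by
          rw [Finset.sum_const, Finset.card_univ, nsmul_eq_mul, ← hN]; ring
      _ = 2 := by rw [ENNReal.inv_mul_cancel hN0 hNt]; simp
  have hmm : Measurable fun y => N⁻¹ * ∑ k, ℓ k y := hs.const_mul _
  have hmm2 : Measurable fun y => (N⁻¹ * ∑ k, ℓ k y) * (N⁻¹ * ∑ k, ℓ k y) := hmm.mul hmm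
  have hkey : (1 : ℝ≥0∞) ≤ ∫⁻ y, min 1 (N⁻¹ * ∑ k, ℓ k y) ∂P + 2⁻¹ := by
    calc (1 : ℝ≥0∞) = ∫⁻ y, N⁻¹ * ∑ k, ℓ k y ∂P := hmean.symm
      _ ≤ ∫⁻ y, (min 1 (N⁻¹ * ∑ k, ℓ k y) +
            (N⁻¹ * ∑ k, ℓ k y) * (N⁻¹ * ∑ k, ℓ k y) * 4⁻¹) ∂P :=
          lintegral_mono fun y => le_min_one_add_sq_div_four _
      _ = ∫⁻ y, min 1 (N⁻¹ * ∑ k, ℓ k y) ∂P +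
            (∫⁻ y, (N⁻¹ * ∑ k, ℓ k y) * (N⁻¹ * ∑ k, ℓ k y) ∂P) * 4⁻¹ := by
          rw [lintegral_add_left (measurable_const.min hmm), lintegral_mul_const _ hmm2]
      _ ≤ ∫⁻ y, min 1 (N⁻¹ * ∑ k, ℓ k y) ∂P + 2 * 4⁻¹ := by gcongr
      _ = _ := by
          congr 1
          rw [show (4 : ℝ≥0∞) = 2 * 2 by norm_num, ENNReal.mul_inv (by simp) (by simp), ← mul_assoc,
            ENNReal.mul_inv_cancel (by simp) (by simp), one_mul]
  have h2 : (1 : ℝ≥0∞) - 2⁻¹ = 2⁻¹ := ENNReal.one_sub_inv_two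
  rw [← h2]
  exact tsub_le_iff_right.mpr hkey

/-- The many hypotheses lower bound: `0` against the mixture of the laws with densities `ℓ k`. -/
theorem le_of_mixture {Y : Type*} [MeasurableSpace Y] (P : Measure Y)
    {ι : Type*} [Fintype ι] [Nonempty ι] {ℓ : ι → Y → ℝ≥0∞}
    (hm : ∀ k, Measurable (ℓ k)) (h1 : ∀ k, ∫⁻ y, ℓ k y ∂P = 1)
    (hoff : ∀ k l, k ≠ l → ∫⁻ y, ℓ k y * ℓ l y ∂P ≤ 1)
    (hdiag : ∀ k, ∫⁻ y, ℓ k y * ℓ k y ∂P ≤ Fintype.card ι)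
    {e : ι → Y → ℝ≥0∞} (he : ∀ k, Measurable (e k)) (δ R : ℝ≥0∞)
    (hR0 : ∫⁻ y, ⨆ k, e k y ∂P ≤ R)
    (hR : ∀ k, ∫⁻ y, (δ - e k y) ∂P.withDensity (ℓ k) ≤ R) :
    δ * 4⁻¹ ≤ R := by
  set N : ℝ≥0∞ := (Fintype.card ι : ℝ≥0∞) with hN
  have hN0 : N ≠ 0 := by simp [hN]
  have hNt : N ≠ ∞ := by simp [hN]
  -- Replacing each `e k` by the supremum only decreases `δ - e k` and makes the integrand the same
  -- for all `k`, so the densities can be averaged.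
  set T : Y → ℝ≥0∞ := fun y => ⨆ k, e k y with hT
  have hTm : Measurable T := Measurable.iSup he
  have hTk : ∀ k, ∫⁻ y, (δ - T y) * ℓ k y ∂P ≤ R := by
    intro k
    refine le_trans ?_ (hR k)
    have hd : Measurable fun y => δ - e k y := measurable_const.sub (he k)
    rw [lintegral_withDensity_eq_lintegral_mul _ (hm k) hd]
    refine lintegral_mono fun y => ?_
    simp only [Pi.mul_apply]
    rw [mul_comm]
    gcongr
    exact le_iSup (fun k => e k y) k
  have hmix : ∫⁻ y, (δ - T y) * (N⁻¹ * ∑ k, ℓ k y) ∂P ≤ R := by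
    have : ∀ y, (δ - T y) * (N⁻¹ * ∑ k, ℓ k y) = N⁻¹ * ∑ k, (δ - T y) * ℓ k y := fun y => by
      rw [← Finset.mul_sum]; ring
    simp_rw [this]
    have hmk : ∀ k, Measurable fun y => (δ - T y) * ℓ k y :=
      fun k => (measurable_const.sub hTm).mul (hm k)
    rw [lintegral_const_mul _ (Finset.measurable_sum _ fun k _ => hmk k),
      lintegral_finsetSum _ fun k _ => hmk k]
    calc N⁻¹ * ∑ k, ∫⁻ y, (δ - T y) * ℓ k y ∂P ≤ N⁻¹ * ∑ _k : ι, R := by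
          gcongr with k; exact hTk k
      _ = (N⁻¹ * N) * R := by rw [Finset.sum_const, Finset.card_univ, nsmul_eq_mul, ← hN]; ring
      _ = R := by rw [ENNReal.inv_mul_cancel hN0 hNt, one_mul]
  have hfin : δ * 2⁻¹ ≤ R + R := by
    calc δ * 2⁻¹ ≤ δ * ∫⁻ y, min 1 (N⁻¹ * ∑ k, ℓ k y) ∂P := by
          gcongr; exact half_le_lintegral_min_average P hm h1 hoff hdiag
      _ = ∫⁻ y, δ * min 1 (N⁻¹ * ∑ k, ℓ k y) ∂P := by
          rw [lintegral_const_mul _ (measurable_const.min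
            ((Finset.measurable_sum _ fun k _ => hm k).const_mul _))]
      _ ≤ ∫⁻ y, (T y + (δ - T y) * (N⁻¹ * ∑ k, ℓ k y)) ∂P := by
          refine lintegral_mono fun y => ?_
          calc δ * min 1 (N⁻¹ * ∑ k, ℓ k y)
              ≤ (T y + (δ - T y)) * min 1 (N⁻¹ * ∑ k, ℓ k y) := by
                gcongr; exact le_add_tsub
            _ = T y * min 1 (N⁻¹ * ∑ k, ℓ k y) + (δ - T y) * min 1 (N⁻¹ * ∑ k, ℓ k y) := add_mul ..
            _ ≤ T y * 1 + (δ - T y) * (N⁻¹ * ∑ k, ℓ k y) := by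
                gcongr
                · exact min_le_left _ _
                · exact min_le_right _ _
            _ = _ := by rw [mul_one]
      _ = ∫⁻ y, T y ∂P + ∫⁻ y, (δ - T y) * (N⁻¹ * ∑ k, ℓ k y) ∂P := lintegral_add_left hTm _
      _ ≤ R + R := add_le_add hR0 hmix
  calc δ * 4⁻¹ = δ * 2⁻¹ * 2⁻¹ := by
        rw [mul_assoc, ← ENNReal.mul_inv (by simp) (by simp)]; norm_num
    _ ≤ (R + R) * 2⁻¹ := by gcongr
    _ = R := by
        rw [← two_mul, mul_comm 2 R, mul_assoc, ENNReal.mul_inv_cancel (by simp) (by simp), mul_one]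

/-- The two hypotheses lower bound for laws with a common part `ν`. -/
theorem le_of_common_part {Y : Type*} [MeasurableSpace Y] {P₀ P₁ ν : Measure Y} (h0 : ν ≤ P₀)
    (h1 : ν ≤ P₁) {e₀ e₁ : Y → ℝ≥0∞} (he : Measurable e₀) (δ R : ℝ≥0∞)
    (hδ : ∀ y, δ ≤ e₀ y + e₁ y) (hR0 : ∫⁻ y, e₀ y ∂P₀ ≤ R) (hR1 : ∫⁻ y, e₁ y ∂P₁ ≤ R) :
    δ * ν Set.univ ≤ 2 * R := by
  calc δ * ν Set.univ = ∫⁻ _, δ ∂ν := by simp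
    _ ≤ ∫⁻ y, (e₀ y + e₁ y) ∂ν := lintegral_mono hδ
    _ = ∫⁻ y, e₀ y ∂ν + ∫⁻ y, e₁ y ∂ν := lintegral_add_left he _
    _ ≤ R + R := add_le_add ((lintegral_mono' h0 le_rfl).trans hR0)
        ((lintegral_mono' h1 le_rfl).trans hR1)
    _ = 2 * R := (two_mul R).symm

/-! ### Product functions in Hölder classes -/

/-- `c ∏ₖ gₖ^{(bₖ)}(xₖ)`. -/
def separable {d : ℕ} (c : ℝ) (g : Fin d → ℝ → ℝ) (b : Fin d → ℕ) (x : Fin d → ℝ) : ℝ :=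
  c * ∏ k, iteratedDeriv (b k) (g k) (x k)

theorem update_mem_cube {d : ℕ} {x : Fin d → ℝ} (hx : x ∈ cube d) (k : Fin d) {t : ℝ}
    (ht : t ∈ Set.Icc (0 : ℝ) 1) : Function.update x k t ∈ cube d := by
  constructor <;> intro i <;> by_cases h : i = k
  · subst h; simpa using ht.1
  · simpa [h] using hx.1 i
  · subst h; simpa using ht.2
  · simpa [h] using hx.2 i

/-- Only one factor depends on the varied coordinate. The function `F` is assumed to agree with the
product on the cube only, because that is all that is known after an earlier one-sided partial
derivative has been taken. -/
theorem hasDerivWithinAt_separable {d : ℕ} (c : ℝ) {g : Fin d → ℝ → ℝ}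
    (hg : ∀ k (j : ℕ), ContDiff ℝ j (g k)) (b : Fin d → ℕ) {F : (Fin d → ℝ) → ℝ}
    (hF : Set.EqOn F (separable c g b) (cube d)) (k : Fin d) {x : Fin d → ℝ} (hx : x ∈ cube d) :
    HasDerivWithinAt (fun t : ℝ => F (Function.update x k t))
      (separable c g (b + Pi.single k 1) x) (Set.Icc 0 1) (x k) := by
  classical
  have hxk : x k ∈ Set.Icc (0 : ℝ) 1 := ⟨hx.1 k, hx.2 k⟩
  set D : ℝ := c * ∏ i ∈ Finset.univ.erase k, iteratedDeriv (b i) (g i) (x i) with hD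
  have hsplit : ∀ t, separable c g b (Function.update x k t) =
      D * iteratedDeriv (b k) (g k) t := by
    intro t
    rw [separable, ← Finset.mul_prod_erase _ _ (Finset.mem_univ k), hD, Function.update_self]
    have : ∏ i ∈ Finset.univ.erase k, iteratedDeriv (b i) (g i) (Function.update x k t i) =
        ∏ i ∈ Finset.univ.erase k, iteratedDeriv (b i) (g i) (x i) :=
      Finset.prod_congr rfl fun i hi => by
        rw [Function.update_of_ne (Finset.ne_of_mem_erase hi)]
    rw [this]
    ring
  have hval : separable c g (b + Pi.single k 1) x = D * iteratedDeriv (b k + 1) (g k) (x k) := by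
    rw [separable, ← Finset.mul_prod_erase _ _ (Finset.mem_univ k), hD]
    have : ∏ i ∈ Finset.univ.erase k, iteratedDeriv ((b + Pi.single k 1 : Fin d → ℕ) i) (g i) (x i) =
        ∏ i ∈ Finset.univ.erase k, iteratedDeriv (b i) (g i) (x i) :=
      Finset.prod_congr rfl fun i hi => by simp [Finset.ne_of_mem_erase hi]
    rw [this]
    simp only [Pi.add_apply, Pi.single_eq_same]
    ring
  have hder : HasDerivAt (iteratedDeriv (b k) (g k)) (iteratedDeriv (b k + 1) (g k) (x k)) (x k) := by
    rw [iteratedDeriv_succ]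
    exact ((hg k (b k + 1)).differentiable_iteratedDeriv (b k)
      (by exact_mod_cast Nat.lt_succ_self _) _).hasDerivAt
  rw [hval]
  refine ((hder.const_mul D).hasDerivWithinAt).congr (fun t ht => ?_) ?_
  · rw [hF (update_mem_cube hx k ht), hsplit]
  · rw [hF (update_mem_cube hx k hxk), hsplit]

theorem hasPartialDeriv_separable {d : ℕ} (c : ℝ) {g : Fin d → ℝ → ℝ}
    (hg : ∀ k (j : ℕ), ContDiff ℝ j (g k)) (b : Fin d → ℕ) {F : (Fin d → ℝ) → ℝ}
    (hF : Set.EqOn F (separable c g b) (cube d)) (k : Fin d) : HasPartialDeriv k F :=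
  fun _ hx => (hasDerivWithinAt_separable c hg b hF k hx).differentiableWithinAt

theorem partialDeriv_iterate_separable {d : ℕ} (c : ℝ) {g : Fin d → ℝ → ℝ}
    (hg : ∀ k (j : ℕ), ContDiff ℝ j (g k)) (b : Fin d → ℕ) {F : (Fin d → ℝ) → ℝ}
    (hF : Set.EqOn F (separable c g b) (cube d)) (k : Fin d) (m : ℕ) :
    Set.EqOn ((partialDeriv k)^[m] F) (separable c g (b + Pi.single k m)) (cube d) := by
  induction m with
  | zero => simpa using hF
  | succ m ih =>
    intro x hx
    have hxk : x k ∈ Set.Icc (0 : ℝ) 1 := ⟨hx.1 k, hx.2 k⟩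
    rw [Function.iterate_succ_apply', Pi.single_add, ← add_assoc]
    exact (hasDerivWithinAt_separable c hg _ ih k hx).derivWithin (uniqueDiffOn_Icc_zero_one _ hxk)

theorem multiDeriv_separable {d : ℕ} (c : ℝ) {g : Fin d → ℝ → ℝ}
    (hg : ∀ k (j : ℕ), ContDiff ℝ j (g k)) (b : Fin d → ℕ) :
    Set.EqOn (multiDeriv b (separable c g 0)) (separable c g b) (cube d) := by
  have hlist : ∀ l : List (Fin d), Set.EqOn
      (l.foldr (fun k F => (partialDeriv k)^[b k] F) (separable c g 0))
      (separable c g ((l.map fun k => Pi.single k (b k)).sum)) (cube d) := by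
    intro l
    induction l with
    | nil => intro x _; rfl
    | cons k l ih =>
      have := partialDeriv_iterate_separable c hg _ ih k (b k)
      rw [List.map_cons, List.sum_cons, add_comm]
      exact this
  have h := hlist (List.finRange d)
  rwa [← Fin.sum_univ_def, Finset.univ_sum_single] at h

/-- The factors are exchanged one at a time. Scaling the increments by the same `B i` as the sizes
lets the full product of the `B i` come out, whichever factor is changed. -/
theorem abs_prod_sub_prod_le {ι : Type*} (s : Finset ι) {u w B : ι → ℝ} {ε : ℝ}
    (hu : ∀ i, |u i| ≤ B i) (hw : ∀ i, |w i| ≤ B i) (huw : ∀ i, |u i - w i| ≤ B i * ε) :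
    |∏ i ∈ s, u i - ∏ i ∈ s, w i| ≤ (∏ i ∈ s, B i) * (s.card * ε) := by
  classical
  have hB : ∀ i, 0 ≤ B i := fun i => (abs_nonneg _).trans (hu i)
  induction s using Finset.induction_on with
  | empty => simp
  | insert i s hi ih =>
    rw [Finset.prod_insert hi, Finset.prod_insert hi, Finset.prod_insert hi,
      Finset.card_insert_of_notMem hi]
    have h1 : u i * ∏ j ∈ s, u j - w i * ∏ j ∈ s, w j =
        u i * (∏ j ∈ s, u j - ∏ j ∈ s, w j) + (u i - w i) * ∏ j ∈ s, w j := by ring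
    have h2 : |∏ j ∈ s, w j| ≤ ∏ j ∈ s, B j := by
      rw [Finset.abs_prod]
      exact Finset.prod_le_prod (fun _ _ => abs_nonneg _) fun j _ => hw j
    rw [h1]
    refine (abs_add_le _ _).trans ?_
    rw [abs_mul, abs_mul]
    have h3 := mul_le_mul (hu i) ih (abs_nonneg _) (hB i)
    have h4 := mul_le_mul (huw i) h2 (abs_nonneg _) ((abs_nonneg _).trans (huw i))
    push_cast
    linarith

theorem strictFloor_lt {α : ℝ} (hα : 0 < α) : (strictFloor α : ℝ) < α :=
  (strictFloor_isGreatest hα).1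

theorem sub_strictFloor_le_one {α : ℝ} (hα : 0 < α) : α - strictFloor α ≤ 1 := by
  by_contra! h
  have h1 : strictFloor α + 1 ∈ {k : ℕ | (k : ℝ) < α} := by
    simp only [Set.mem_ofPred_eq]
    push_cast
    linarith
  have := (strictFloor_isGreatest hα).2 h1
  omega

/-- A product function at scale `h`, scaled by `h ^ α`, is in the Hölder class. -/
theorem separable_mem_holderClass {d : ℕ} (hd : 1 ≤ d) {α L A c h : ℝ} (hα : 0 < α)
    {g : Fin d → ℝ → ℝ} (hg : ∀ k (j : ℕ), ContDiff ℝ j (g k)) (hh : 0 < h) (hh1 : h ≤ 1) (hA : 0 ≤ A)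
    (hbd : ∀ k, ∀ j ≤ strictFloor α + 1, ∀ t, |iteratedDeriv j (g k) t| ≤ A * h⁻¹ ^ j)
    (hc : 0 ≤ c) (hL : c * (A ^ d * (1 + 2 * d)) ≤ L) :
    (fun x : Fin d → ℝ => c * h ^ α * ∏ k, g k (x k)) ∈ holderClass d α L := by
  have heq : (fun x : Fin d → ℝ => c * h ^ α * ∏ k, g k (x k)) = separable (c * h ^ α) g 0 := by
    ext x
    simp [separable]
  rw [heq]
  set m := strictFloor α with hm
  have hmα : (m : ℝ) < α := strictFloor_lt hα
  have hm1 : α - m ≤ 1 := sub_strictFloor_le_one hα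
  have hdr : (1 : ℝ) ≤ d := by exact_mod_cast hd
  have hhα : 0 ≤ h ^ α := (Real.rpow_pos_of_pos hh α).le
  have hprod : ∀ b : Fin d → ℕ, ∏ k, A * h⁻¹ ^ b k = A ^ d * h⁻¹ ^ (∑ k, b k) := by
    intro b
    rw [Finset.prod_mul_distrib, Finset.prod_const, Finset.card_univ, Fintype.card_fin,
      Finset.prod_pow_eq_pow_sum]
  have hble : ∀ b : Fin d → ℕ, ∑ k, b k ≤ m → ∀ k, b k ≤ m := fun b hb k =>
    (Finset.single_le_sum (f := b) (fun _ _ => Nat.zero_le _) (Finset.mem_univ k)).trans hb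
  have habs : ∀ b : Fin d → ℕ, ∑ k, b k ≤ m → ∀ x : Fin d → ℝ,
      |∏ k, iteratedDeriv (b k) (g k) (x k)| ≤ A ^ d * h⁻¹ ^ (∑ k, b k) := by
    intro b hb x
    rw [Finset.abs_prod, ← hprod]
    exact Finset.prod_le_prod (fun _ _ => abs_nonneg _) fun k _ =>
      hbd k _ ((hble b hb k).trans (Nat.le_succ m)) _
  refine ⟨fun b _ k => hasPartialDeriv_separable _ hg b (multiDeriv_separable _ hg b) k, ?_⟩
  have hfirst : (⨆ (b : Fin d → ℕ) (_ : ∑ k, b k ≤ strictFloor α) (x ∈ cube d),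
      ‖multiDeriv b (separable (c * h ^ α) g 0) x‖ₑ) ≤ ENNReal.ofReal (c * A ^ d) := by
    refine iSup_le fun b => iSup_le fun hb => iSup_le fun x => iSup_le fun hx => ?_
    rw [multiDeriv_separable _ hg b hx, Real.enorm_eq_ofReal_abs]
    refine ENNReal.ofReal_le_ofReal ?_
    rw [separable, abs_mul, abs_of_nonneg (mul_nonneg hc hhα), mul_assoc]
    refine mul_le_mul_of_nonneg_left ?_ hc
    have h1 : h ^ α ≤ h ^ (∑ k, b k) := by
      rw [← Real.rpow_natCast]
      refine Real.rpow_le_rpow_of_exponent_ge hh hh1 ?_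
      have : ((∑ k, b k : ℕ) : ℝ) ≤ m := by exact_mod_cast hb
      linarith
    calc h ^ α * |∏ k, iteratedDeriv (b k) (g k) (x k)|
        ≤ h ^ (∑ k, b k) * (A ^ d * h⁻¹ ^ (∑ k, b k)) :=
          mul_le_mul h1 (habs b hb x) (abs_nonneg _) (by positivity)
      _ = A ^ d := by
          rw [inv_pow]
          field_simp
  have hsecond : (⨆ (b : Fin d → ℕ) (_ : ∑ k, b k = strictFloor α) (x ∈ cube d) (y ∈ cube d)
      (_ : x ≠ y), ‖multiDeriv b (separable (c * h ^ α) g 0) x -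
        multiDeriv b (separable (c * h ^ α) g 0) y‖ₑ /
          ENNReal.ofReal (‖x - y‖ ^ (α - strictFloor α))) ≤
      ENNReal.ofReal (c * A ^ d * (2 * d)) := by
    refine iSup_le fun b => iSup_le fun hb => iSup_le fun x => iSup_le fun hx => iSup_le fun y =>
      iSup_le fun hy => iSup_le fun hxy => ?_
    rw [multiDeriv_separable _ hg b hx, multiDeriv_separable _ hg b hy, Real.enorm_eq_ofReal_abs]
    refine ENNReal.div_le_of_le_mul ?_
    rw [← ENNReal.ofReal_mul (by positivity)]
    refine ENNReal.ofReal_le_ofReal ?_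
    rw [separable, separable, ← mul_sub, abs_mul, abs_of_nonneg (mul_nonneg hc hhα), ← hm]
    set Δ := ∏ k, iteratedDeriv (b k) (g k) (x k) - ∏ k, iteratedDeriv (b k) (g k) (y k) with hΔ
    set ε := ‖x - y‖ / h with hε
    have hε0 : 0 ≤ ε := by positivity
    have hlip : |Δ| ≤ A ^ d * h⁻¹ ^ m * (d * ε) := by
      have h0 := abs_prod_sub_prod_le Finset.univ
        (u := fun k => iteratedDeriv (b k) (g k) (x k))
        (w := fun k => iteratedDeriv (b k) (g k) (y k)) (B := fun k => A * h⁻¹ ^ b k) (ε := ε)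
        (fun k => hbd k _ ((hble b hb.le k).trans (Nat.le_succ m)) _)
        (fun k => hbd k _ ((hble b hb.le k).trans (Nat.le_succ m)) _) ?_
      · rwa [hprod, hb, Finset.card_univ, Fintype.card_fin] at h0
      · intro k
        have h1 := Convex.norm_image_sub_le_of_norm_deriv_le (𝕜 := ℝ) (s := Set.univ)
          (f := iteratedDeriv (b k) (g k)) (x := y k) (y := x k) (C := A * h⁻¹ ^ (b k + 1))
          (fun t _ => (hg k (b k + 1)).differentiable_iteratedDeriv (b k)
            (by exact_mod_cast Nat.lt_succ_self _) t)
          (fun t _ => by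
            rw [← iteratedDeriv_succ]
            exact hbd k _ (Nat.succ_le_succ (hble b hb.le k)) t)
          convex_univ trivial trivial
        simp only [Real.norm_eq_abs] at h1
        refine h1.trans ?_
        have h2 : |x k - y k| ≤ ‖x - y‖ := norm_le_pi_norm (x - y) k
        calc A * h⁻¹ ^ (b k + 1) * |x k - y k| ≤ A * h⁻¹ ^ (b k + 1) * ‖x - y‖ := by gcongr
          _ = A * h⁻¹ ^ b k * ε := by rw [hε, pow_succ]; ring
    have hbdd : |Δ| ≤ A ^ d * h⁻¹ ^ m * 2 := by
      have h1 := habs b hb.le x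
      have h2 := habs b hb.le y
      rw [hb] at h1 h2
      refine (abs_sub _ _).trans ?_
      linarith
    have hK : 0 ≤ A ^ d * h⁻¹ ^ m := by positivity
    -- Interpolation between the Lipschitz and the trivial bound: since `0 < α - m ≤ 1`, the power
    -- `ε ^ (α - m)` dominates `ε` for `ε ≤ 1` and dominates `1` for `ε ≥ 1`.
    have hpow : |Δ| ≤ A ^ d * h⁻¹ ^ m * (2 * d * ε ^ (α - m)) := by
      rcases le_total ε 1 with h1 | h1
      · refine hlip.trans (mul_le_mul_of_nonneg_left ?_ hK)
        have h2 : ε ≤ ε ^ (α - m) := by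
          rcases hε0.eq_or_lt with h0 | h0
          · rw [← h0]
            exact Real.rpow_nonneg le_rfl _
          · conv_lhs => rw [← Real.rpow_one ε]
            exact Real.rpow_le_rpow_of_exponent_ge h0 h1 hm1
        nlinarith [Real.rpow_nonneg hε0 (α - m)]
      · refine hbdd.trans (mul_le_mul_of_nonneg_left ?_ hK)
        have h2 : 1 ≤ ε ^ (α - m) := Real.one_le_rpow h1 (by linarith)
        nlinarith
    have hscale : h ^ α * h⁻¹ ^ m * ε ^ (α - m) = ‖x - y‖ ^ (α - m) := by
      rw [hε, Real.div_rpow (norm_nonneg _) hh.le, Real.rpow_sub hh, Real.rpow_natCast, inv_pow]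
      have := (Real.rpow_pos_of_pos hh α).ne'
      field_simp
    calc c * h ^ α * |Δ| ≤ c * h ^ α * (A ^ d * h⁻¹ ^ m * (2 * d * ε ^ (α - m))) :=
          mul_le_mul_of_nonneg_left hpow (mul_nonneg hc hhα)
      _ = c * A ^ d * (2 * d) * (h ^ α * h⁻¹ ^ m * ε ^ (α - m)) := by ring
      _ = _ := by rw [hscale]
  calc holderNorm α (separable (c * h ^ α) g 0)
      ≤ ENNReal.ofReal (c * A ^ d) + ENNReal.ofReal (c * A ^ d * (2 * d)) :=
        add_le_add hfirst hsecond
    _ = ENNReal.ofReal (c * A ^ d + c * A ^ d * (2 * d)) :=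
        (ENNReal.ofReal_add (by positivity) (by positivity)).symm
    _ ≤ ENNReal.ofReal L := ENNReal.ofReal_le_ofReal (by linarith)

theorem const_mem_holderClass {d : ℕ} (hd : 1 ≤ d) {α L c : ℝ} (hα : 0 < α) (hc : 0 ≤ c)
    (hL : c * (1 + 2 * d) ≤ L) : (fun _ : Fin d → ℝ => c) ∈ holderClass d α L := by
  have h := separable_mem_holderClass hd (A := 1) (c := c) (h := 1) (L := L) hα
    (g := fun _ _ => 1) (fun _ _ => contDiff_const) one_pos le_rfl zero_le_one
    (fun k j _ t => by
      rw [iteratedDeriv_const]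
      split_ifs <;> simp) hc (by simpa using hL)
  simpa using h

/-! ### Localised bumps -/

/-- A smooth bump on `(0, 1)` with peak value `1` at `1 / 2`. -/
def unitBump : ContDiffBump (1 / 2 : ℝ) := ⟨1 / 4, 1 / 2, by norm_num, by norm_num⟩

/-- The product bump supported in the cube with lower corner `a` and side length `h`. -/
def cubeBump {d : ℕ} (a : Fin d → ℝ) (h : ℝ) (x : Fin d → ℝ) : ℝ :=
  ∏ k, unitBump (h⁻¹ * (x k - a k))

theorem cubeBump_nonneg {d : ℕ} (a : Fin d → ℝ) (h : ℝ) (x : Fin d → ℝ) : 0 ≤ cubeBump a h x :=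
  Finset.prod_nonneg fun _ _ => unitBump.nonneg

theorem cubeBump_le_one {d : ℕ} (a : Fin d → ℝ) (h : ℝ) (x : Fin d → ℝ) : cubeBump a h x ≤ 1 :=
  Finset.prod_le_one (fun _ _ => unitBump.nonneg) fun _ _ => unitBump.le_one

theorem cubeBump_center {d : ℕ} (a : Fin d → ℝ) {h : ℝ} (hh : 0 < h) :
    cubeBump a h (fun k => a k + h / 2) = 1 := by
  refine Finset.prod_eq_one fun k _ => unitBump.one_of_mem_closedBall ?_
  have : h⁻¹ * (a k + h / 2 - a k) = 1 / 2 := by field_simp; ring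
  rw [this]
  exact Metric.mem_closedBall_self unitBump.rIn_pos.le

theorem cubeBump_eq_zero {d : ℕ} {a x : Fin d → ℝ} {h : ℝ} (hh : 0 < h) (k : Fin d)
    (hk : x k ∉ Set.Ioo (a k) (a k + h)) : cubeBump a h x = 0 := by
  refine Finset.prod_eq_zero (Finset.mem_univ k) (unitBump.zero_of_le_dist ?_)
  change (1 / 2 : ℝ) ≤ dist (h⁻¹ * (x k - a k)) (1 / 2)
  by_contra! hlt
  rw [Real.dist_eq, abs_lt] at hlt
  refine hk ⟨?_, ?_⟩
  · have : 0 < h⁻¹ * (x k - a k) := by linarith [hlt.1]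
    have := (pos_iff_pos_of_mul_pos this).mp (inv_pos.mpr hh)
    linarith
  · have h1 : h⁻¹ * (x k - a k) < 1 := by linarith [hlt.2]
    rw [inv_mul_lt_iff₀ hh] at h1
    linarith

theorem exists_unitBump_deriv_bound (m : ℕ) :
    ∃ A : ℝ, 0 < A ∧ ∀ j ≤ m, ∀ t, |iteratedDeriv j unitBump t| ≤ A := by
  have hsupp : HasCompactSupport unitBump := unitBump.hasCompactSupport
  have hj : ∀ j : ℕ, ∃ B : ℝ, ∀ t, |iteratedDeriv j unitBump t| ≤ B := by
    intro j
    have hc : HasCompactSupport (iteratedDeriv j unitBump) := by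
      induction j with
      | zero => simpa using hsupp
      | succ j ih =>
        rw [iteratedDeriv_succ]
        exact ih.deriv
    exact hc.exists_bound_of_continuous ((unitBump.contDiff (n := j)).continuous_iteratedDeriv j
      le_rfl)
  choose B hB using hj
  have hB0 : ∀ j, 0 ≤ B j := fun j => (abs_nonneg _).trans (hB j 0)
  refine ⟨1 + ∑ j ∈ Finset.range (m + 1), B j, ?_, fun j hjm t => ?_⟩
  · have := Finset.sum_nonneg fun j (_ : j ∈ Finset.range (m + 1)) => hB0 j
    linarith
  · have := Finset.single_le_sum (f := B) (fun j _ => hB0 j)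
      (Finset.mem_range.mpr (Nat.lt_succ_of_le hjm))
    linarith [hB j t]

/-- Translation does not affect derivative bounds, and each derivative costs one factor `h⁻¹`, which
the height `h ^ α` compensates. The admissible constant is therefore uniform in the width and the
position. -/
theorem exists_cubeBump_mem_holderClass {d : ℕ} (hd : 1 ≤ d) {α L : ℝ} (hα : 0 < α) (hL : 0 < L) :
    ∃ c₀ : ℝ, 0 < c₀ ∧ ∀ c, 0 ≤ c → c ≤ c₀ → ∀ h, 0 < h → h ≤ 1 → ∀ a : Fin d → ℝ,
      (fun x => c * h ^ α * cubeBump a h x) ∈ holderClass d α L := by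
  obtain ⟨A, hA, hAb⟩ := exists_unitBump_deriv_bound (strictFloor α + 1)
  have hK : 0 < A ^ d * (1 + 2 * d) := by positivity
  refine ⟨L / (A ^ d * (1 + 2 * d)), by positivity, fun c hc hcc h hh hh1 a => ?_⟩
  refine separable_mem_holderClass (g := fun k t => unitBump (h⁻¹ * (t - a k))) hd hα
    (fun k j => ?_) hh hh1 hA.le (fun k j hj t => ?_) hc ((le_div_iff₀ hK).mp hcc)
  · exact unitBump.contDiff.comp (contDiff_const.mul (contDiff_id.sub contDiff_const))
  · have h1 := congrFun (iteratedDeriv_comp_sub_const j (fun s => unitBump (h⁻¹ * s)) (a k)) t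
    rw [h1, iteratedDeriv_comp_const_mul (unitBump.contDiff (n := j)) h⁻¹]
    rw [abs_mul, abs_of_nonneg (by positivity), mul_comm]
    exact mul_le_mul_of_nonneg_right (hAb j hj _) (by positivity)

/-! ### Random fields that are constant in space -/

/-- The field that is constantly `a` with probability `q` and constantly `b` otherwise. -/
def twoPointField (d : ℕ) (q : ℝ) (hq0 : 0 ≤ q) (hq1 : q ≤ 1) (a b : ℝ) : RandomField d where
  Ω := Bool
  P := ENNReal.ofReal q • Measure.dirac true + ENNReal.ofReal (1 - q) • Measure.dirac false
  isProb := ⟨by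
    simp [← ENNReal.ofReal_add hq0 (sub_nonneg.mpr hq1)]⟩
  Z := fun _ ω => bif ω then a else b
  meas := fun _ _ => measurable_of_finite _

theorem integral_twoPointField {d : ℕ} {q : ℝ} (hq0 : 0 ≤ q) (hq1 : q ≤ 1) (a b : ℝ)
    (g : Bool → ℝ) :
    ∫ ω, g ω ∂(twoPointField d q hq0 hq1 a b).P = q * g true + (1 - q) * g false := by
  have hint : ∀ ν : Measure Bool, IsFiniteMeasure ν → Integrable g ν := fun ν _ =>
    Integrable.of_finite
  change ∫ ω, g ω ∂(ENNReal.ofReal q • Measure.dirac true +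
    ENNReal.ofReal (1 - q) • Measure.dirac false) = _
  rw [integral_add_measure ((hint _ inferInstance).smul_measure ENNReal.ofReal_ne_top)
      ((hint _ inferInstance).smul_measure ENNReal.ofReal_ne_top), integral_smul_measure,
    integral_smul_measure, integral_dirac, integral_dirac, ENNReal.toReal_ofReal hq0,
    ENNReal.toReal_ofReal (sub_nonneg.mpr hq1), smul_eq_mul, smul_eq_mul]

theorem twoPointField_mem_processClass {d : ℕ} {q : ℝ} (hq0 : 0 ≤ q) (hq1 : q ≤ 1) {a b β₀ C : ℝ}
    (hβ : β₀ ≤ 1) (hC : 0 < C) (hmean : q * a + (1 - q) * b = 0)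
    (hsq : q * a ^ 2 + (1 - q) * b ^ 2 ≤ C / 2) :
    twoPointField d q hq0 hq1 a b ∈ processClass d β₀ C := by
  have hM : 0 < Real.sqrt (C / 2) := Real.sqrt_pos.mpr (by positivity)
  have hΩ : Finite (twoPointField d q hq0 hq1 a b).Ω := inferInstanceAs (Finite Bool)
  have hΩ' : DiscreteMeasurableSpace (twoPointField d q hq0 hq1 a b).Ω :=
    inferInstanceAs (DiscreteMeasurableSpace Bool)
  -- The paths are constant, so the exponent `1` and any positive `M` satisfy the path condition. A
  -- constant `M` with `M ^ 2 = C / 2` leaves the other half of the budget for the second moment of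
  -- the field.
  refine ⟨fun x _ => ⟨?_, ?_⟩, 1, ⟨hβ, le_rfl⟩, fun _ => Real.sqrt (C / 2), measurable_const,
    fun _ => hM, memLp_const _, ?_, ae_of_all _ fun ω x _ y _ => ?_⟩
  · exact MemLp.of_discrete
  · exact (integral_twoPointField hq0 hq1 a b fun ω => bif ω then a else b).trans hmean
  · have h2 : ∫ ω, (twoPointField d q hq0 hq1 a b).Z 0 ω ^ 2 ∂(twoPointField d q hq0 hq1 a b).P =
        q * a ^ 2 + (1 - q) * b ^ 2 :=
      integral_twoPointField hq0 hq1 a b fun ω => (bif ω then a else b) ^ 2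
    rw [h2]
    simp only [integral_const, probReal_univ, one_smul, Real.sq_sqrt (by positivity : 0 ≤ C / 2)]
    linarith
  · simp only [twoPointField, sub_self, abs_zero]
    positivity

/-- The field that vanishes identically. -/
def zeroField (d : ℕ) : RandomField d := twoPointField d 0 le_rfl zero_le_one 0 0

theorem zeroField_mem_processClass {d : ℕ} {β₀ C : ℝ} (hβ : β₀ ≤ 1) (hC : 0 < C) :
    zeroField d ∈ processClass d β₀ C :=
  twoPointField_mem_processClass _ _ hβ hC (by simp) (by simp; positivity)

theorem obsLaw_zeroField {d n : ℕ} {p : Fin d → ℕ} (x : ∀ k, Fin (p k) → ℝ) (v : ℝ≥0)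
    (μ : (Fin d → ℝ) → ℝ) :
    obsLaw n x v μ (zeroField d) =
      (noiseLaw n (GridIndex p) v).map fun y i j => μ (gridPoint x j) + y i j := by
  have hZ : ∀ z ω, (zeroField d).Z z ω = 0 := fun z ω => by
    cases ω <;> rfl
  have hm : Measurable fun (y : Fin n → GridIndex p → ℝ) i j => μ (gridPoint x j) + y i j := by
    fun_prop
  unfold obsLaw
  simp only [hZ, add_zero]
  have : (fun (q : (Fin n → (zeroField d).Ω) × (Fin n → GridIndex p → ℝ)) i j =>
      μ (gridPoint x j) + q.2 i j) =
      (fun (y : Fin n → GridIndex p → ℝ) i j => μ (gridPoint x j) + y i j) ∘ Prod.snd := rfl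
  rw [this, ← Measure.map_map hm measurable_snd, Measure.map_snd_prod]
  simp [noiseLaw]

theorem obsLaw_zeroField_zero {d n : ℕ} {p : Fin d → ℕ} (x : ∀ k, Fin (p k) → ℝ) (v : ℝ≥0) :
    obsLaw n x v (fun _ => 0) (zeroField d) = noiseLaw n (GridIndex p) v := by
  rw [obsLaw_zeroField]
  simp

/-- On the event that all `n` fields take the value `-δ`, the shift cancels exactly and only noise
remains. This event is independent of the noise and has probability `(1 - q) ^ n`. -/
theorem smul_noiseLaw_le_obsLaw_twoPointField {d n : ℕ} {p : Fin d → ℕ} (x : ∀ k, Fin (p k) → ℝ)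
    (v : ℝ≥0) {q : ℝ} (hq0 : 0 ≤ q) (hq1 : q ≤ 1) (a δ : ℝ) :
    ENNReal.ofReal ((1 - q) ^ n) • noiseLaw n (GridIndex p) v ≤
      obsLaw n x v (fun _ => δ) (twoPointField d q hq0 hq1 a (-δ)) := by
  refine Measure.le_iff.mpr fun s hs => ?_
  set Z := twoPointField d q hq0 hq1 a (-δ) with hZ
  have hZm : ∀ j, Measurable (Z.Z j) := fun j => measurable_of_finite (α := Bool) _
  have hm : Measurable fun (r : (Fin n → Z.Ω) × (Fin n → GridIndex p → ℝ)) i j =>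
      δ + Z.Z (gridPoint x j) (r.1 i) + r.2 i j := by
    refine measurable_pi_lambda _ fun i => measurable_pi_lambda _ fun j => ?_
    refine Measurable.add (measurable_const.add ((hZm _).comp ?_)) ?_
    · exact (measurable_pi_apply i).comp measurable_fst
    · fun_prop
  have hP : Z.P {(false : Bool)} = ENNReal.ofReal (1 - q) := by
    change (ENNReal.ofReal q • Measure.dirac true +
      ENNReal.ofReal (1 - q) • Measure.dirac false : Measure Bool) {false} = _
    simp
  have hsing : (Measure.pi fun _ : Fin n => Z.P) (Set.univ.pi fun _ => {(false : Bool)}) =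
      ENNReal.ofReal ((1 - q) ^ n) := by
    rw [Measure.pi_pi]
    simp [hP, ENNReal.ofReal_pow (sub_nonneg.mpr hq1)]
  unfold obsLaw
  rw [Measure.map_apply hm hs, Measure.smul_apply, smul_eq_mul, ← hsing, noiseLaw,
    ← Measure.prod_prod]
  refine measure_mono ?_
  rintro ⟨ω, y⟩ ⟨hω, hy⟩
  have hfalse : ∀ i, ω i = (false : Bool) := fun i => hω i trivial
  have : (fun i j => δ + Z.Z (gridPoint x j) (ω i) + y i j) = y := by
    ext i j
    rw [hfalse i]
    change δ + -δ + y i j = y i j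
    ring
  change (fun i j => δ + Z.Z (gridPoint x j) (ω i) + y i j) ∈ s
  rwa [this]

/-! ### Lower bounds for the maximal risk of an estimator -/

/-- The maximal risk of an estimator, not normalised. -/
def maxRisk {d : ℕ} (α L β₀ C_Z : ℝ) (v : ℝ≥0) (n : ℕ) (p : Fin d → ℕ)
    (x : ∀ k, Fin (p k) → ℝ) (m : Obs n p → (Fin d → ℝ) → ℝ) : ℝ≥0∞ :=
  ⨆ μ ∈ holderClass d α L, ⨆ Z ∈ processClass d β₀ C_Z,
    ∫⁻ y, supDist (m y) μ ∂(obsLaw n x v μ Z)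

theorem lintegral_supDist_le_maxRisk {d : ℕ} {α L β₀ C_Z : ℝ} {v : ℝ≥0} {n : ℕ} {p : Fin d → ℕ}
    {x : ∀ k, Fin (p k) → ℝ} (m : Obs n p → (Fin d → ℝ) → ℝ) {μ : (Fin d → ℝ) → ℝ}
    (hμ : μ ∈ holderClass d α L) {Z : RandomField d} (hZ : Z ∈ processClass d β₀ C_Z) :
    ∫⁻ y, supDist (m y) μ ∂(obsLaw n x v μ Z) ≤ maxRisk α L β₀ C_Z v n p x m :=
  le_iSup₂_of_le μ hμ (le_iSup₂_of_le Z hZ le_rfl)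

theorem enorm_le_supDist {d : ℕ} (f g : (Fin d → ℝ) → ℝ) {z : Fin d → ℝ} (hz : z ∈ cube d) :
    ‖f z - g z‖ₑ ≤ supDist f g :=
  le_iSup₂_of_le (f := fun x (_ : x ∈ cube d) => ‖f x - g x‖ₑ) z hz le_rfl

theorem zero_mem_holderClass {d : ℕ} (hd : 1 ≤ d) {α L : ℝ} (hα : 0 < α) (hL : 0 < L) :
    (fun _ : Fin d → ℝ => (0 : ℝ)) ∈ holderClass d α L :=
  const_mem_holderClass hd hα le_rfl (by simpa using hL.le)

/-- Two regression functions, one of them zero, whose observation laws have a common part. -/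
theorem le_maxRisk_of_common_part {d : ℕ} (hd : 1 ≤ d) {α L β₀ C_Z : ℝ} (hα : 0 < α) (hL : 0 < L)
    (hβ : β₀ ≤ 1) (hC : 0 < C_Z) {v : ℝ≥0} {n : ℕ} {p : Fin d → ℕ} {x : ∀ k, Fin (p k) → ℝ}
    {m : Obs n p → (Fin d → ℝ) → ℝ} (hm : m ∈ estimators n p) {μ : (Fin d → ℝ) → ℝ}
    (hμ : μ ∈ holderClass d α L) {Z : RandomField d} (hZ : Z ∈ processClass d β₀ C_Z)
    {z : Fin d → ℝ} (hz : z ∈ cube d) {ρ : ℝ} (hz0 : 0 ≤ μ z)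
    (hν : ENNReal.ofReal ρ • noiseLaw n (GridIndex p) v ≤ obsLaw n x v μ Z) (hρ1 : ρ ≤ 1) :
    ENNReal.ofReal (μ z * ρ / 2) ≤ maxRisk α L β₀ C_Z v n p x m := by
  have h0 : ENNReal.ofReal ρ • noiseLaw n (GridIndex p) v ≤
      obsLaw n x v (fun _ => 0) (zeroField d) := by
    rw [obsLaw_zeroField_zero]
    refine Measure.le_iff.mpr fun s _ => ?_
    rw [Measure.smul_apply, smul_eq_mul]
    exact mul_le_of_le_one_left' (ENNReal.ofReal_le_one.mpr hρ1)
  have h := le_of_common_part h0 hν (e₀ := fun y => ‖m y z‖ₑ) (e₁ := fun y => ‖m y z - μ z‖ₑ)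
    (hm z hz).enorm (ENNReal.ofReal (μ z)) (maxRisk α L β₀ C_Z v n p x m)
    (fun y => ?_) ?_ ?_
  · simp only [Measure.smul_apply, measure_univ, smul_eq_mul, mul_one] at h
    rw [← ENNReal.ofReal_mul hz0] at h
    rw [ENNReal.ofReal_div_of_pos two_pos]
    refine ENNReal.div_le_of_le_mul ?_
    rw [mul_comm (maxRisk _ _ _ _ _ _ _ _ _)]
    simpa using h
  · calc ENNReal.ofReal (μ z) = ‖m y z - (m y z - μ z)‖ₑ := by
          rw [sub_sub_cancel, Real.enorm_eq_ofReal hz0]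
      _ ≤ _ := enorm_sub_le
  · refine le_trans (lintegral_mono fun y => ?_) (lintegral_supDist_le_maxRisk m
      (zero_mem_holderClass hd hα hL) (zeroField_mem_processClass hβ hC))
    simpa using enorm_le_supDist (m y) (fun _ => 0) hz
  · exact le_trans (lintegral_mono fun y => enorm_le_supDist (m y) μ hz)
      (lintegral_supDist_le_maxRisk m hμ hZ)

/-- The parametric lower bound. A rare large value of `Z` masks a shift of order `n ^ (-1/2)`. -/
theorem exists_le_maxRisk_parametric {d : ℕ} (hd : 1 ≤ d) {α L β₀ C_Z : ℝ} (hα : 0 < α)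
    (hL : 0 < L) (hβ : β₀ ≤ 1) (hC : 0 < C_Z) (v : ℝ≥0) :
    ∃ c : ℝ, 0 < c ∧ ∀ n : ℕ, 1 ≤ n → ∀ (p : Fin d → ℕ) (x : ∀ k, Fin (p k) → ℝ),
      ∀ m ∈ estimators n p,
        ENNReal.ofReal (c * (n : ℝ) ^ (-(1 / 2) : ℝ)) ≤ maxRisk α L β₀ C_Z v n p x m := by
  have hD : (0 : ℝ) < 1 + 2 * d := by positivity
  -- The first entry keeps the variance of the field within `C_Z / 2`, the second puts the constant
  -- function into the Hölder class.
  set c₁ : ℝ := min (Real.sqrt C_Z / 2) (L / (1 + 2 * d)) with hc₁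
  have hc₁0 : 0 < c₁ := lt_min (by positivity) (by positivity)
  refine ⟨c₁ / 4, by positivity, fun n hn p x m hm => ?_⟩
  have hnr : (1 : ℝ) ≤ n := by exact_mod_cast hn
  have hn0 : (0 : ℝ) < n := by linarith
  set r : ℝ := (n : ℝ) ^ (-(1 / 2) : ℝ) with hr
  have hr0 : 0 < r := Real.rpow_pos_of_pos hn0 _
  have hr1 : r ≤ 1 := Real.rpow_le_one_of_one_le_of_nonpos hnr (by norm_num)
  have hrr : r ^ 2 = (n : ℝ)⁻¹ := by
    rw [hr, ← Real.rpow_natCast, ← Real.rpow_mul hn0.le, ← Real.rpow_neg_one]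
    norm_num
  -- Small enough for Bernoulli's inequality to give `(1 - q) ^ n ≥ 1 / 2`, yet large enough for the
  -- variance `δ ^ 2 * (1 - q) / q` to stay bounded.
  set q : ℝ := 1 / (2 * n) with hq
  have hq0 : 0 < q := by positivity
  have hq1 : q ≤ 1 := by
    rw [hq, div_le_one (by positivity)]
    linarith
  set δ : ℝ := c₁ * r with hδ
  have hδ0 : 0 < δ := by positivity
  have hδsq : δ ^ 2 / q ≤ C_Z / 2 := by
    have h1 : c₁ ^ 2 ≤ C_Z / 4 := by
      calc c₁ ^ 2 ≤ (Real.sqrt C_Z / 2) ^ 2 := by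
            gcongr
            exact min_le_left _ _
        _ = C_Z / 4 := by rw [div_pow, Real.sq_sqrt hC.le]; norm_num
    have h2 : δ ^ 2 / q = 2 * c₁ ^ 2 := by
      rw [hδ, mul_pow, hrr, hq]
      field_simp
    linarith
  -- The rare value is forced by centering against `-δ`.
  have hZ : twoPointField d q hq0.le hq1 (δ * (1 - q) / q) (-δ) ∈ processClass d β₀ C_Z := by
    refine twoPointField_mem_processClass hq0.le hq1 hβ hC ?_ ?_
    · field_simp
      ring
    · have h1 : q * (δ * (1 - q) / q) ^ 2 + (1 - q) * (-δ) ^ 2 = δ ^ 2 / q * (1 - q) := by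
        field_simp
        ring
      rw [h1]
      have : 0 ≤ δ ^ 2 / q := by positivity
      nlinarith
  have hμ : (fun _ : Fin d → ℝ => δ) ∈ holderClass d α L := by
    refine const_mem_holderClass hd hα hδ0.le ?_
    rw [← le_div_iff₀ hD]
    have : c₁ ≤ L / (1 + 2 * d) := min_le_right _ _
    nlinarith
  have hbern : 1 / 2 ≤ (1 - q) ^ n := by
    have h1 := one_add_mul_le_pow (a := -q) (by linarith) n
    have h2 : (n : ℝ) * -q = -(1 / 2) := by
      rw [hq]
      field_simp
    rw [← sub_eq_add_neg] at h1
    linarith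
  have hρ1 : (1 - q) ^ n ≤ 1 := pow_le_one₀ (by linarith) (by linarith)
  have h := le_maxRisk_of_common_part hd hα hL hβ hC hm hμ hZ (z := 0) ⟨le_rfl, zero_le_one⟩
    hδ0.le (smul_noiseLaw_le_obsLaw_twoPointField x v hq0.le hq1 _ δ) hρ1
  refine le_trans (ENNReal.ofReal_le_ofReal ?_) h
  nlinarith

/-! ### The design -/

/-- The upper bounds on the densities make the distribution functions Lipschitz; their sum serves as
a constant common to all directions, and the added `1` gives `1 ≤ F`. -/
theorem exists_integral_le {d : ℕ} {f : Fin d → ℝ → ℝ} (hf : ∀ k, IsDesignDensity (f k)) :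
    ∃ F : ℝ, 1 ≤ F ∧ ∀ k, ∀ s ∈ Set.Icc (0 : ℝ) 1, ∀ t ∈ Set.Icc (0 : ℝ) 1,
      |(∫ u in (0 : ℝ)..t, f k u) - ∫ u in (0 : ℝ)..s, f k u| ≤ F * |t - s| := by
  choose lo hi hlo hb using fun k => (hf k).bounds
  have h0 : (0 : ℝ) ∈ Set.Icc (0 : ℝ) 1 := ⟨le_rfl, zero_le_one⟩
  have hhi : ∀ k, 0 ≤ hi k := fun k => by
    have := hb k 0 h0
    linarith [hlo k]
  have hsum : 0 ≤ ∑ k, hi k := Finset.sum_nonneg fun k _ => hhi k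
  refine ⟨1 + ∑ k, hi k, by linarith, fun k s hs t ht => ?_⟩
  obtain ⟨K, hK⟩ := (hf k).lipschitz
  have hii : ∀ a ∈ Set.Icc (0 : ℝ) 1, ∀ b ∈ Set.Icc (0 : ℝ) 1,
      IntervalIntegrable (f k) volume a b := fun a ha b hb =>
    (hK.continuousOn.mono (Set.uIcc_subset_Icc ha hb)).intervalIntegrable
  rw [intervalIntegral.integral_interval_sub_left (hii 0 h0 t ht) (hii 0 h0 s hs)]
  have h1 := intervalIntegral.norm_integral_le_of_norm_le_const (f := f k) (a := s) (b := t)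
    (C := hi k) fun u hu => by
      have hu' := Set.uIcc_subset_Icc hs ht (Set.uIoc_subset_uIcc hu)
      have := hb k u hu'
      rw [Real.norm_eq_abs, abs_le]
      constructor <;> linarith [hlo k]
  refine h1.trans ?_
  have h2 : hi k ≤ ∑ k, hi k := Finset.single_le_sum (fun k _ => hhi k) (Finset.mem_univ k)
  gcongr
  linarith

/-- The lowest quantile level is `1 / (2 * p k)`, owing to the half-step offset, and a distribution
function with slope at most `F` needs this distance from `0` to reach it. -/
theorem IsDesign.le_coord {d : ℕ} {f : Fin d → ℝ → ℝ} {p : Fin d → ℕ} {x : ∀ k, Fin (p k) → ℝ}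
    (hx : IsDesign f p x) {F : ℝ} (hF1 : 1 ≤ F)
    (hF : ∀ k, ∀ s ∈ Set.Icc (0 : ℝ) 1, ∀ t ∈ Set.Icc (0 : ℝ) 1,
      |(∫ u in (0 : ℝ)..t, f k u) - ∫ u in (0 : ℝ)..s, f k u| ≤ F * |t - s|)
    (k : Fin d) (l : Fin (p k)) : (2 * F * p k)⁻¹ ≤ x k l := by
  have hp : (0 : ℝ) < p k := by
    have : 0 < p k := Nat.lt_of_le_of_lt (Nat.zero_le _) l.2
    exact_mod_cast this
  obtain ⟨hmem, hint⟩ := hx k l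
  have h := hF k 0 ⟨le_rfl, zero_le_one⟩ _ hmem
  rw [hint, intervalIntegral.integral_same, sub_zero, sub_zero, abs_of_nonneg hmem.1] at h
  have h2 := (le_abs_self _).trans h
  rw [div_le_iff₀ hp] at h2
  rw [inv_le_iff_one_le_mul₀ (by positivity)]
  have : (0 : ℝ) ≤ ((l : ℕ) : ℝ) := Nat.cast_nonneg _
  norm_num at h2
  linarith

theorem card_le_of_forall_abs_sub_le {N : ℕ} (s : Finset (Fin N)) {D : ℝ} (hD : 0 ≤ D)
    (h : ∀ i ∈ s, ∀ j ∈ s, |((j : ℕ) : ℝ) - ((i : ℕ) : ℝ)| ≤ D) : (s.card : ℝ) ≤ D + 1 := by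
  rcases s.eq_empty_or_nonempty with rfl | hs
  · simp
    linarith
  have hsub : s ⊆ Finset.Icc (s.min' hs) (s.max' hs) := fun i hi =>
    Finset.mem_Icc.mpr ⟨s.min'_le i hi, s.le_max' i hi⟩
  have hcard := Finset.card_le_card hsub
  rw [Fin.card_Icc] at hcard
  have h1 := (le_abs_self _).trans (h _ (s.min'_mem hs) _ (s.max'_mem hs))
  have h2 : s.card ≤ (s.max' hs : ℕ) - (s.min' hs : ℕ) + 1 := by omega
  have h3 : (s.min' hs : ℕ) ≤ (s.max' hs : ℕ) := s.min'_le_max' hs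
  have h4 : (s.card : ℝ) ≤ (((s.max' hs : ℕ) - (s.min' hs : ℕ) + 1 : ℕ) : ℝ) := by
    exact_mod_cast h2
  rw [Nat.cast_add, Nat.cast_sub h3, Nat.cast_one] at h4
  linarith

/-- Coordinates within distance `h` have quantile levels within `F * h`, hence indices within `F * h
* p k`. The extra `1` from counting endpoints is absorbed by `1 ≤ h * p k`. -/
theorem IsDesign.card_Ioo_le {d : ℕ} {f : Fin d → ℝ → ℝ} {p : Fin d → ℕ} {x : ∀ k, Fin (p k) → ℝ}
    (hx : IsDesign f p x) {F : ℝ} (hF1 : 1 ≤ F)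
    (hF : ∀ k, ∀ s ∈ Set.Icc (0 : ℝ) 1, ∀ t ∈ Set.Icc (0 : ℝ) 1,
      |(∫ u in (0 : ℝ)..t, f k u) - ∫ u in (0 : ℝ)..s, f k u| ≤ F * |t - s|)
    (k : Fin d) (a : ℝ) {h : ℝ} (hh : 0 < h) (hhp : 1 ≤ h * p k) (s : Finset (Fin (p k)))
    (hs : ∀ l ∈ s, x k l ∈ Set.Ioo a (a + h)) : (s.card : ℝ) ≤ (F + 1) * (h * p k) := by
  have hp : (0 : ℝ) < p k := pos_of_mul_pos_right (by linarith) hh.le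
  have h1 := card_le_of_forall_abs_sub_le s (D := F * h * p k) (by positivity) fun i hi j hj => by
    obtain ⟨hmi, hii⟩ := hx k i
    obtain ⟨hmj, hij⟩ := hx k j
    have h2 := hF k _ hmi _ hmj
    rw [hii, hij, ← sub_div, abs_div, abs_of_pos hp, div_le_iff₀ hp] at h2
    have h3 : |x k j - x k i| ≤ h := by
      have := hs i hi
      have := hs j hj
      simp only [Set.mem_Ioo] at *
      rw [abs_le]
      constructor <;> linarith
    have h4 : (((j : ℕ) : ℝ) + 1 - 0.5 - (((i : ℕ) : ℝ) + 1 - 0.5)) = ((j : ℕ) : ℝ) - (i : ℕ) := by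
      ring
    rw [h4] at h2
    refine h2.trans ?_
    gcongr
  linarith

/-- The squared bump is at most the indicator of its supporting box, and the number of points of a
product design in a box is the product of the coordinate counts. -/
theorem sum_sq_cubeBump_le {d : ℕ} {f : Fin d → ℝ → ℝ} {p : Fin d → ℕ} {x : ∀ k, Fin (p k) → ℝ}
    (hx : IsDesign f p x) {F : ℝ} (hF1 : 1 ≤ F)
    (hF : ∀ k, ∀ s ∈ Set.Icc (0 : ℝ) 1, ∀ t ∈ Set.Icc (0 : ℝ) 1,
      |(∫ u in (0 : ℝ)..t, f k u) - ∫ u in (0 : ℝ)..s, f k u| ≤ F * |t - s|)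
    (a : Fin d → ℝ) {h : ℝ} (hh : 0 < h) (hhp : ∀ k, 1 ≤ h * p k) :
    ∑ j, cubeBump a h (gridPoint x j) ^ 2 ≤ ((F + 1) * h) ^ d * ∏ k, (p k : ℝ) := by
  classical
  set S : ∀ k, Finset (Fin (p k)) :=
    fun k => Finset.univ.filter fun l => x k l ∈ Set.Ioo (a k) (a k + h) with hS
  have hle : ∀ j : GridIndex p, cubeBump a h (gridPoint x j) ^ 2 ≤
      if j ∈ Fintype.piFinset S then 1 else 0 := by
    intro j
    split_ifs with hj
    · exact pow_le_one₀ (cubeBump_nonneg _ _ _) (cubeBump_le_one _ _ _)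
    · simp only [Fintype.mem_piFinset, hS, Finset.mem_filter, Finset.mem_univ, true_and,
        not_forall] at hj
      obtain ⟨k, hk⟩ := hj
      rw [cubeBump_eq_zero hh k hk]
      simp
  refine (Finset.sum_le_sum fun j _ => hle j).trans ?_
  rw [Finset.sum_ite_mem, Finset.univ_inter, Finset.sum_const, nsmul_eq_mul, mul_one,
    Fintype.card_piFinset, Nat.cast_prod]
  calc ∏ k, ((S k).card : ℝ) ≤ ∏ k, (F + 1) * (h * p k) :=
        Finset.prod_le_prod (fun _ _ => Nat.cast_nonneg _) fun k _ =>
          hx.card_Ioo_le hF1 hF k (a k) hh (hhp k) (S k) fun l hl => (Finset.mem_filter.mp hl).2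
    _ = _ := by
        simp_rw [← mul_assoc]
        rw [Finset.prod_mul_distrib, Finset.prod_const, Finset.card_univ, Fintype.card_fin]

/-! ### The discretisation and the stochastic lower bound -/

/-- The discretisation lower bound, from a bump that vanishes at all design points. -/
theorem exists_le_maxRisk_discretisation {d : ℕ} (hd : 1 ≤ d) {α L β₀ C_Z : ℝ} (hα : 0 < α)
    (hL : 0 < L) (hβ : β₀ ≤ 1) (hC : 0 < C_Z) (v : ℝ≥0) {f : Fin d → ℝ → ℝ}
    (hf : ∀ k, IsDesignDensity (f k)) :
    ∃ c : ℝ, 0 < c ∧ ∀ (n : ℕ) (p : Fin d → ℕ), (∀ k, 1 ≤ p k) →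
      ∀ x : ∀ k, Fin (p k) → ℝ, IsDesign f p x → ∀ m ∈ estimators n p,
        ENNReal.ofReal (c * ((⨅ k, p k : ℕ) : ℝ) ^ (-α)) ≤ maxRisk α L β₀ C_Z v n p x m := by
  obtain ⟨F, hF1, hF⟩ := exists_integral_le hf
  obtain ⟨c₀, hc₀, hmem⟩ := exists_cubeBump_mem_holderClass hd hα hL
  have hF0 : 0 < F := by linarith
  refine ⟨c₀ * ((2 * F)⁻¹) ^ α / 2, by positivity, fun n p hp x hx m hm => ?_⟩
  have : Nonempty (Fin d) := ⟨⟨0, hd⟩⟩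
  obtain ⟨k, hk⟩ := exists_eq_ciInf_of_finite (f := p)
  have hpk : (1 : ℝ) ≤ p k := by exact_mod_cast hp k
  rw [← hk]
  -- The distance from the face to the first design layer in the coarsest direction: a bump of this
  -- width at the origin misses every design point.
  set h : ℝ := (2 * F * p k)⁻¹ with hh
  have hh0 : 0 < h := by positivity
  have hh1 : h ≤ 1 := by
    rw [hh]
    refine inv_le_one_of_one_le₀ ?_
    nlinarith
  have hzero : ∀ j, c₀ * h ^ α * cubeBump 0 h (gridPoint x j) = 0 := fun j => by
    rw [cubeBump_eq_zero hh0 k, mul_zero]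
    rintro ⟨-, h2⟩
    have := hx.le_coord hF1 hF k (j k)
    simp only [gridPoint, Pi.zero_apply, zero_add] at h2
    linarith
  have hlaw : ENNReal.ofReal 1 • noiseLaw n (GridIndex p) v ≤
      obsLaw n x v (fun z => c₀ * h ^ α * cubeBump 0 h z) (zeroField d) := by
    rw [obsLaw_zeroField]
    simp [hzero]
  have hval : c₀ * h ^ α * cubeBump (0 : Fin d → ℝ) h (fun _ => h / 2) = c₀ * h ^ α := by
    have := cubeBump_center (0 : Fin d → ℝ) hh0
    simp only [Pi.zero_apply, zero_add] at this
    rw [this, mul_one]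
  have hpos : 0 < c₀ * h ^ α := by positivity
  have hz : (fun _ => h / 2 : Fin d → ℝ) ∈ cube d :=
    ⟨fun _ => by simp only [Pi.zero_apply]; linarith,
      fun _ => by simp only [Pi.one_apply]; linarith⟩
  have hle := le_maxRisk_of_common_part hd hα hL hβ hC hm (hmem c₀ hc₀.le le_rfl h hh0 hh1 0)
    (zeroField_mem_processClass hβ hC) hz (hval.ge.trans' hpos.le) hlaw le_rfl
  refine le_trans (ENNReal.ofReal_le_ofReal (le_of_eq ?_)) hle
  rw [hval, hh, mul_inv (2 * F), Real.mul_rpow (by positivity) (by positivity),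
    Real.inv_rpow (Nat.cast_nonneg (p k)), Real.rpow_neg (Nat.cast_nonneg (p k))]
  ring

/-- The lower bound from `⌊1 / h⌋` bumps of width `h` that cannot be told apart from zero. -/
theorem le_maxRisk_of_exp_le {d : ℕ} (hd : 1 ≤ d) {α L β₀ C_Z : ℝ} (hα : 0 < α) (hL : 0 < L)
    (hβ : β₀ ≤ 1) (hC : 0 < C_Z) {v : ℝ≥0} (hv : v ≠ 0) {f : Fin d → ℝ → ℝ} {F : ℝ} (hF1 : 1 ≤ F)
    (hF : ∀ k, ∀ s ∈ Set.Icc (0 : ℝ) 1, ∀ t ∈ Set.Icc (0 : ℝ) 1,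
      |(∫ u in (0 : ℝ)..t, f k u) - ∫ u in (0 : ℝ)..s, f k u| ≤ F * |t - s|)
    {n : ℕ} {p : Fin d → ℕ} {x : ∀ k, Fin (p k) → ℝ} (hx : IsDesign f p x)
    {m : Obs n p → (Fin d → ℝ) → ℝ} (hm : m ∈ estimators n p) {δ h : ℝ} (hδ : 0 ≤ δ) (hh : 0 < h)
    (hh1 : h ≤ 1) (hhp : ∀ k, 1 ≤ h * p k)
    (hmem : ∀ a : Fin d → ℝ, (fun z => δ * cubeBump a h z) ∈ holderClass d α L)
    (hexp : Real.exp (n * (δ ^ 2 * (((F + 1) * h) ^ d * ∏ k, (p k : ℝ))) / v) ≤ ⌊1 / h⌋₊) :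
    ENNReal.ofReal (δ / 4) ≤ maxRisk α L β₀ C_Z v n p x m := by
  set N : ℕ := ⌊1 / h⌋₊ with hN
  have hN1 : 1 ≤ N := by
    rw [hN, Nat.one_le_floor_iff, le_div_iff₀ hh]
    linarith
  have hNh : N * h ≤ 1 := by
    rw [← le_div_iff₀ hh]
    exact Nat.floor_le (by positivity)
  have : Nonempty (Fin N) := ⟨⟨0, hN1⟩⟩
  set k₀ : Fin d := ⟨0, hd⟩
  -- Shifts along a single coordinate suffice. The number of bumps matters only through its
  -- logarithm, so using of order `h⁻¹` instead of `h⁻¹ ^ d` bumps costs only a constant.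
  set a : Fin N → Fin d → ℝ := fun l => Pi.single k₀ (((l : ℕ) : ℝ) * h) with ha
  have ha0 : ∀ l k, 0 ≤ a l k ∧ a l k + h ≤ 1 := by
    intro l k
    by_cases hk : k = k₀
    · subst hk
      have h1 : ((l : ℕ) : ℝ) + 1 ≤ N := by exact_mod_cast l.2
      simp only [ha, Pi.single_eq_same]
      refine ⟨by positivity, ?_⟩
      nlinarith
    · simp only [ha, Pi.single_eq_of_ne hk]
      exact ⟨le_rfl, by linarith⟩
  set z : Fin N → Fin d → ℝ := fun l k => a l k + h / 2 with hz
  have hzc : ∀ l, z l ∈ cube d := fun l =>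
    ⟨fun k => by simp only [hz, Pi.zero_apply]; linarith [ha0 l k],
      fun k => by simp only [hz, Pi.one_apply]; linarith [ha0 l k]⟩
  have hdisj : ∀ l l', l < l' → ∀ y, cubeBump (a l) h y * cubeBump (a l') h y = 0 := by
    intro l l' hll y
    have h1 : ((l : ℕ) : ℝ) + 1 ≤ (l' : ℕ) := by exact_mod_cast hll
    by_cases hy : y k₀ ∈ Set.Ioo (a l k₀) (a l k₀ + h)
    · rw [cubeBump_eq_zero (a := a l') hh k₀, mul_zero]
      simp only [ha, Pi.single_eq_same, Set.mem_Ioo] at hy ⊢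
      rintro ⟨h2, -⟩
      nlinarith
    · rw [cubeBump_eq_zero hh k₀ hy, zero_mul]
  have hdisj' : ∀ l l', l ≠ l' → ∀ y, cubeBump (a l) h y * cubeBump (a l') h y = 0 := by
    intro l l' hll y
    rcases lt_or_gt_of_ne hll with h1 | h1
    · exact hdisj l l' h1 y
    · rw [mul_comm]
      exact hdisj l' l h1 y
  set θ : Fin N → GridIndex p → ℝ := fun l j => δ * cubeBump (a l) h (gridPoint x j) with hθ
  -- The integrand is the density of a pushforward of a probability measure.
  have hone : ∀ l, ∫⁻ y, shiftRatio v (θ l) y ∂noiseLaw n (GridIndex p) v = 1 := by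
    intro l
    have hmeas : Measurable fun (y : Fin n → GridIndex p → ℝ) i j => θ l j + y i j := by fun_prop
    have := Measure.isProbabilityMeasure_map (μ := noiseLaw n (GridIndex p) v) hmeas.aemeasurable
    rw [noiseLaw_map_shift hv] at this
    have h1 := this.measure_univ
    rwa [withDensity_apply _ MeasurableSet.univ, Measure.restrict_univ] at h1
  have hlaw : ∀ l, obsLaw n x v (fun y => δ * cubeBump (a l) h y) (zeroField d) =
      (noiseLaw n (GridIndex p) v).withDensity (shiftRatio v (θ l)) := fun l => by
    rw [obsLaw_zeroField]
    exact noiseLaw_map_shift hv (θ l)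
  have hmain := le_of_mixture (noiseLaw n (GridIndex p) v) (ℓ := fun l => shiftRatio v (θ l))
    (fun l => measurable_shiftRatio v (θ l)) hone
    (fun l l' hll => by
      rw [lintegral_shiftRatio_mul hv]
      have : ∑ j, θ l j * θ l' j = 0 := Finset.sum_eq_zero fun j _ => by
        have h1 := hdisj' l l' hll (gridPoint x j)
        calc θ l j * θ l' j =
            δ ^ 2 * (cubeBump (a l) h (gridPoint x j) * cubeBump (a l') h (gridPoint x j)) := by
              simp only [hθ]; ring
          _ = 0 := by rw [h1, mul_zero]
      simp [this])
    (fun l => by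
      rw [lintegral_shiftRatio_mul hv, Fintype.card_fin, ← ENNReal.ofReal_natCast]
      refine ENNReal.ofReal_le_ofReal (le_trans (Real.exp_le_exp.mpr ?_) hexp)
      have h1 := sum_sq_cubeBump_le hx hF1 hF (a l) hh hhp
      have h2 : ∑ j, θ l j * θ l j = δ ^ 2 * ∑ j, cubeBump (a l) h (gridPoint x j) ^ 2 := by
        rw [Finset.mul_sum]
        exact Finset.sum_congr rfl fun j _ => by simp only [hθ]; ring
      rw [h2]
      gcongr)
    -- Evaluating the estimator at the `l`-th peak serves both sides: it is the error there under
    -- the zero function, and `δ` minus it bounds from below the error under the `l`-th bump.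
    (e := fun l y => ‖m y (z l)‖ₑ) (fun l => (hm _ (hzc l)).enorm) (ENNReal.ofReal δ)
    (maxRisk α L β₀ C_Z v n p x m) ?_ ?_
  · rw [ENNReal.ofReal_div_of_pos (by norm_num), div_eq_mul_inv]
    simpa using hmain
  · have h0 := lintegral_supDist_le_maxRisk (n := n) (x := x) (v := v) m
      (zero_mem_holderClass hd hα hL) (zeroField_mem_processClass (d := d) hβ hC)
    rw [obsLaw_zeroField_zero] at h0
    refine le_trans (lintegral_mono fun y => iSup_le fun l => ?_) h0
    simpa using enorm_le_supDist (m y) (fun _ => 0) (hzc l)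
  · intro l
    rw [← hlaw]
    refine le_trans (lintegral_mono fun y => ?_) (lintegral_supDist_le_maxRisk m
      (hmem (a l)) (zeroField_mem_processClass hβ hC))
    refine le_trans ?_ (enorm_le_supDist (m y) _ (hzc l))
    have hc : cubeBump (a l) h (z l) = 1 := cubeBump_center (a l) hh
    rw [hc, mul_one, tsub_le_iff_right]
    calc ENNReal.ofReal δ = ‖m y (z l) - (m y (z l) - δ)‖ₑ := by
          rw [sub_sub_cancel, Real.enorm_eq_ofReal hδ]
      _ ≤ ‖m y (z l)‖ₑ + ‖m y (z l) - δ‖ₑ := enorm_sub_le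
      _ = _ := add_comm _ _

/-- This is `log N = o(N ^ (1/2))` after taking the `τ`-th root. It guarantees polynomially many
bumps; the factor `1 / 2` pays for the rounding in `⌊1 / h⌋₊`. -/
theorem eventually_bandwidth_le {τ : ℝ} (hτ : 0 < τ) :
    ∀ᶠ N : ℝ in atTop, 1 < N ∧
      (Real.log N / N) ^ (1 / τ) ≤ 1 / 2 * N ^ (-(1 / (2 * τ))) := by
  have h1 := (isLittleO_log_rpow_atTop (r := 1 / 2) (by norm_num)).bound
    (c := (1 / 2 : ℝ) ^ τ) (by positivity)
  filter_upwards [h1, eventually_gt_atTop 1] with N hN hN1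
  refine ⟨hN1, ?_⟩
  have hN0 : 0 < N := by linarith
  have hlog : 0 < Real.log N := Real.log_pos hN1
  rw [Real.norm_of_nonneg hlog.le, Real.norm_of_nonneg (by positivity)] at hN
  have h2 : Real.log N / N ≤ (1 / 2 : ℝ) ^ τ * N ^ (-(1 / 2) : ℝ) := by
    rw [div_le_iff₀ hN0, mul_assoc]
    refine hN.trans (le_of_eq ?_)
    congr 1
    nth_rewrite 3 [← Real.rpow_one N]
    rw [← Real.rpow_add hN0]
    norm_num
  calc (Real.log N / N) ^ (1 / τ) ≤ ((1 / 2 : ℝ) ^ τ * N ^ (-(1 / 2) : ℝ)) ^ (1 / τ) :=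
        Real.rpow_le_rpow (by positivity) h2 (by positivity)
    _ = _ := by
        rw [Real.mul_rpow (by positivity) (by positivity), ← Real.rpow_mul (by norm_num),
          ← Real.rpow_mul hN0.le, mul_one_div_cancel hτ.ne', Real.rpow_one]
        congr 2
        field_simp

/-- The stochastic lower bound, for bandwidths that are not smaller than the design spacing. -/
theorem exists_le_maxRisk_stochastic {d : ℕ} (hd : 1 ≤ d) {α L β₀ C_Z : ℝ} (hα : 0 < α)
    (hL : 0 < L) (hβ : β₀ ≤ 1) (hC : 0 < C_Z) {v : ℝ≥0} (hv : v ≠ 0) {f : Fin d → ℝ → ℝ}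
    (hf : ∀ k, IsDesignDensity (f k)) :
    ∃ c N₀ : ℝ, 0 < c ∧ ∀ (n : ℕ) (p : Fin d → ℕ) (N h : ℝ), N = n * ∏ k, (p k : ℝ) → N₀ ≤ N →
      h = (Real.log N / N) ^ (1 / (2 * α + d)) → (∀ k, 1 ≤ h * p k) →
      ∀ x : ∀ k, Fin (p k) → ℝ, IsDesign f p x → ∀ m ∈ estimators n p,
        ENNReal.ofReal (c * h ^ α) ≤ maxRisk α L β₀ C_Z v n p x m := by
  obtain ⟨F, hF1, hF⟩ := exists_integral_le hf
  obtain ⟨c₀, hc₀, hmem⟩ := exists_cubeBump_mem_holderClass hd hα hL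
  set τ : ℝ := 2 * α + d with hτdef
  have hτ : 0 < τ := by positivity
  obtain ⟨N₀, hN₀⟩ := eventually_atTop.mp (eventually_bandwidth_le hτ)
  have hv0 : (0 : ℝ) < v := by
    have : 0 < v := pos_iff_ne_zero.mpr hv
    exact_mod_cast this
  set K : ℝ := (F + 1) ^ d / v with hK
  have hK0 : 0 < K := by positivity
  set γ : ℝ := 1 / (2 * τ) with hγ
  have hγ0 : 0 < γ := by positivity
  -- The first entry ensures membership in the Hölder class. The second keeps the information in one
  -- bump, `c₁ ^ 2 * K * log N`, below `γ * log N`, the logarithm of the guaranteed number `N ^ γ`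
  -- of bumps.
  set c₁ : ℝ := min c₀ (Real.sqrt (γ / K)) with hc₁
  have hc₁0 : 0 < c₁ := lt_min hc₀ (by positivity)
  have hc₁K : c₁ ^ 2 * K ≤ γ := by
    rw [← le_div_iff₀ hK0]
    calc c₁ ^ 2 ≤ Real.sqrt (γ / K) ^ 2 := by
          gcongr
          exact min_le_right _ _
      _ = γ / K := Real.sq_sqrt (by positivity)
  refine ⟨c₁ / 4, N₀, by positivity, fun n p N h hNdef hN hhdef hhp x hx m hm => ?_⟩
  obtain ⟨hN1, hbw⟩ := hN₀ N hN
  have hN0 : 0 < N := by linarith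
  have hlog : 0 < Real.log N := Real.log_pos hN1
  rw [← hhdef] at hbw
  have hh0 : 0 < h := by
    rw [hhdef]
    positivity
  have hNγ : 1 ≤ N ^ γ := Real.one_le_rpow hN1.le hγ0.le
  have hbw' : h * (2 * N ^ γ) ≤ 1 := by
    rw [Real.rpow_neg hN0.le] at hbw
    calc h * (2 * N ^ γ) ≤ 1 / 2 * (N ^ γ)⁻¹ * (2 * N ^ γ) := by gcongr
      _ = 1 := by field_simp
  have hh1 : h ≤ 1 := by nlinarith
  have hfloor : N ^ γ ≤ (⌊1 / h⌋₊ : ℝ) := by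
    have h1 : 2 * N ^ γ ≤ 1 / h := by
      rw [le_div_iff₀ hh0]
      linarith
    have h2 := Nat.sub_one_lt_floor (1 / h)
    linarith
  have hhτ : h ^ τ = Real.log N / N := by
    rw [hhdef, ← Real.rpow_mul (by positivity), one_div_mul_cancel hτ.ne', Real.rpow_one]
  have hexp : Real.exp (n * ((c₁ * h ^ α) ^ 2 * (((F + 1) * h) ^ d * ∏ k, (p k : ℝ))) / v) ≤
      ⌊1 / h⌋₊ := by
    refine le_trans ?_ hfloor
    rw [Real.rpow_def_of_pos hN0]
    refine Real.exp_le_exp.mpr ?_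
    -- Squared height times volume is `h ^ (2α + d)`, which the bandwidth balances to `log N / N`.
    have h1 : (h ^ α) ^ 2 * h ^ d = h ^ τ := by
      rw [hτdef, Real.rpow_add hh0, Real.rpow_natCast, mul_comm 2 α, Real.rpow_mul hh0.le]
      norm_cast
    calc n * ((c₁ * h ^ α) ^ 2 * (((F + 1) * h) ^ d * ∏ k, (p k : ℝ))) / v
        = c₁ ^ 2 * K * (((h ^ α) ^ 2 * h ^ d) * (n * ∏ k, (p k : ℝ))) := by
          rw [hK, mul_pow, mul_pow]
          ring
      _ = c₁ ^ 2 * K * Real.log N := by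
          rw [h1, hhτ, ← hNdef]
          field_simp
      _ ≤ γ * Real.log N := by gcongr
      _ = Real.log N * γ := mul_comm _ _
  have h := le_maxRisk_of_exp_le hd hα hL hβ hC hv hF1 hF hx hm (δ := c₁ * h ^ α) (by positivity)
    hh0 hh1 hhp (hmem c₁ hc₁0.le (min_le_left _ _) h hh0 hh1) hexp
  rwa [div_mul_eq_mul_div]

/-! ### The minimax risk -/

theorem le_minimaxRisk {d : ℕ} {α L β₀ C_Z c : ℝ} {v : ℝ≥0} {n : ℕ} {p : Fin d → ℕ}
    {x : ∀ k, Fin (p k) → ℝ} (hrate : 0 < rate α n p)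
    (h : ∀ m ∈ estimators n p, ENNReal.ofReal (c * rate α n p) ≤ maxRisk α L β₀ C_Z v n p x m) :
    ENNReal.ofReal c ≤ minimaxRisk α L β₀ C_Z v n p x := by
  refine le_iInf₂ fun m hm => ?_
  have hr0 : ENNReal.ofReal (rate α n p) ≠ 0 := by simpa using hrate
  have hrt : (ENNReal.ofReal (rate α n p))⁻¹ ≠ ∞ := ENNReal.inv_ne_top.mpr hr0
  have heq : (⨆ μ ∈ holderClass d α L, ⨆ Z ∈ processClass d β₀ C_Z,
      ∫⁻ y, (ENNReal.ofReal (rate α n p))⁻¹ * supDist (m y) μ ∂(obsLaw n x v μ Z)) =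
      (ENNReal.ofReal (rate α n p))⁻¹ * maxRisk α L β₀ C_Z v n p x m := by
    -- The factor is finite, so it leaves the integral without any measurability of the supremum
    -- distance.
    simp_rw [maxRisk, ENNReal.mul_iSup, lintegral_const_mul' _ _ hrt]
  rw [heq]
  calc ENNReal.ofReal c = (ENNReal.ofReal (rate α n p))⁻¹ * ENNReal.ofReal (c * rate α n p) := by
        rw [ENNReal.ofReal_mul' hrate.le, mul_comm (ENNReal.ofReal c), ← mul_assoc,
          ENNReal.inv_mul_cancel hr0 ENNReal.ofReal_ne_top, one_mul]
    _ ≤ _ := by gcongr; exact h m hm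

end FDAMean

end

theorem theorem2 (d : ℕ) (hd : 1 ≤ d) (α L β₀ C_Z : ℝ) (hα : 0 < α) (hL : 0 < L)
    (hβ₀ : 0 < β₀) (hβ₀' : β₀ ≤ 1) (hC : 0 < C_Z) (v : ℝ≥0) (hv : 0 < v)
    (f : Fin d → ℝ → ℝ) (hf : ∀ k, FDAMean.IsDesignDensity (f k))
    (x : ∀ p : Fin d → ℕ, ∀ k, Fin (p k) → ℝ) (hx : ∀ p, FDAMean.IsDesign f p (x p)) :
    ∃ c : ℝ, 0 < c ∧
      ENNReal.ofReal c ≤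
        liminf (fun np : ℕ × (Fin d → ℕ) =>
          FDAMean.minimaxRisk α L β₀ C_Z v np.1 np.2 (x np.2)) (atTop ×ˢ atTop) := by
  obtain ⟨c₁, hc₁, h₁⟩ :=
    FDAMean.exists_le_maxRisk_discretisation hd hα hL hβ₀' hC v hf
  obtain ⟨c₂, N₀, hc₂, h₂⟩ :=
    FDAMean.exists_le_maxRisk_stochastic hd hα hL hβ₀' hC hv.ne' hf
  obtain ⟨c₃, hc₃, h₃⟩ := FDAMean.exists_le_maxRisk_parametric hd hα hL hβ₀' hC v
  have hc : 0 < min c₁ (min c₂ c₃) := lt_min hc₁ (lt_min hc₂ hc₃)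
  refine ⟨min c₁ (min c₂ c₃), hc, le_liminf_of_le (by isBoundedDefault) ?_⟩
  -- Two curves make `log N` positive, and `n ≥ N₀` passes to `N` because the product of the `p k`
  -- is at least `1`.
  filter_upwards [prod_mem_prod (eventually_ge_atTop (max 2 ⌈N₀⌉₊))
    (eventually_ge_atTop (fun _ : Fin d => 1))] with ⟨n, p⟩ ⟨hn, hp⟩
  have hp1 : ∀ k, 1 ≤ p k := hp
  have hn2 : 2 ≤ n := (le_max_left _ _).trans hn
  have hnN : N₀ ≤ n := (Nat.le_ceil N₀).trans (by exact_mod_cast (le_max_right _ _).trans hn)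
  have hn0 : (0 : ℝ) < n := by exact_mod_cast (by omega : 0 < n)
  have hprod : 1 ≤ ∏ k, (p k : ℝ) := Finset.one_le_prod fun k _ => by exact_mod_cast hp1 k
  set N : ℝ := n * ∏ k, (p k : ℝ) with hN
  have hNn : (n : ℝ) ≤ N := le_mul_of_one_le_right hn0.le hprod
  have hN1 : 1 < N := lt_of_lt_of_le (by exact_mod_cast (by omega : 1 < n)) hNn
  have hlog : 0 < Real.log N := Real.log_pos hN1
  set h : ℝ := (Real.log N / N) ^ (1 / (2 * α + d)) with hh
  have hh0 : 0 < h := by positivity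
  have hhα : (Real.log N / N) ^ (α / (2 * α + d)) = h ^ α := by
    rw [hh, ← Real.rpow_mul (by positivity), one_div_mul_eq_div]
  have hrate : FDAMean.rate α n p = max (((⨅ k, p k : ℕ) : ℝ) ^ (-α))
      (max (h ^ α) ((n : ℝ) ^ (-(1 / 2) : ℝ))) := by
    rw [FDAMean.rate, ← hN, hhα]
  have hrate0 : 0 < FDAMean.rate α n p := by
    rw [hrate]
    exact lt_max_of_lt_right (lt_max_of_lt_left (by positivity))
  refine FDAMean.le_minimaxRisk hrate0 fun m hm => ?_
  have hdis := h₁ n p hp1 (x p) (hx p) m hm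
  have key : ∀ c' r : ℝ, 0 ≤ r → min c₁ (min c₂ c₃) ≤ c' → ENNReal.ofReal (c' * r) ≤
      FDAMean.maxRisk α L β₀ C_Z v n p (x p) m →
      ENNReal.ofReal (min c₁ (min c₂ c₃) * r) ≤ FDAMean.maxRisk α L β₀ C_Z v n p (x p) m :=
    fun c' r hr hc' hle => le_trans (ENNReal.ofReal_le_ofReal (by gcongr)) hle
  have hdis' := key _ _ (by positivity) (min_le_left _ _) hdis
  rw [hrate, mul_max_of_nonneg _ _ hc.le, mul_max_of_nonneg _ _ hc.le, ENNReal.ofReal_max,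
    ENNReal.ofReal_max]
  refine max_le hdis' (max_le ?_ ?_)
  · by_cases hhp : ∀ k, 1 ≤ h * p k
    · exact key _ _ (by positivity) ((min_le_right _ _).trans (min_le_left _ _))
        (h₂ n p N h hN (hnN.trans hNn) hh hhp (x p) (hx p) m hm)
    · push Not at hhp
      obtain ⟨k, hk⟩ := hhp
      refine le_trans (ENNReal.ofReal_le_ofReal (mul_le_mul_of_nonneg_left ?_ hc.le)) hdis'
      have : Nonempty (Fin d) := ⟨k⟩
      have hmin1 : 1 ≤ ⨅ k, p k := le_ciInf hp1
      have hmin0 : (0 : ℝ) < ((⨅ k, p k : ℕ) : ℝ) := by exact_mod_cast hmin1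
      have hmink : ((⨅ k, p k : ℕ) : ℝ) ≤ p k := by
        exact_mod_cast ciInf_le (OrderBot.bddBelow _) k
      rw [Real.rpow_neg hmin0.le, ← Real.inv_rpow hmin0.le]
      refine Real.rpow_le_rpow hh0.le ?_ hα.le
      rw [← one_div, le_div_iff₀ hmin0]
      nlinarith
  · exact key _ _ (by positivity) ((min_le_right _ _).trans (min_le_right _ _))
      (h₃ n (by omega) p (x p) m hm)
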